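/- Let $X$ be a finite alphabet with $|X|\ge 2$ and let $X^*$ be the set of finite words over $X$. A self-similar group over $X$ is a group $G$ with a faithful action on $X^*$ by length-preserving permutations such that for all $g\in G$, $x\in X$ there is $g|_x\in G$ (the section of $g$ at $x$) with $g(xw)=g(x)\,g|_x(w)$ for all $w\in X^*$; for words put $g|_{\varepsilon}=g$ and $g|_{xv}=(g|_x)|_v$. An automaton in $G$ is a finite subset of $G$ closed under taking sections. The group $G$ is contracting if there is an automaton $N\subseteq G$ such that for every $g\in G$ there is $n\ge 0$ with $g|_w\in N$ for all words $w$ of length $n$; the smallest such $N$ is the nucleus of $G$. For a field $K$, the Nekrashevych algebra $\mathcal N_K(G,X)$ is the unital $*$-algebra over $K$ (with $K$-linear involution) generated by $X\cup G$ subject to the relations $g^*=g^{-1}$, $g\cdot h=gh$ for $g,h\in G$ (the identity of $G$ being the identity of the algebra), $gx=g(x)\,g|_x$ for $g\in G$, $x\in X$, $y^*x=\delta_{x,y}$ for $x,y\in X$, and $\sum_{x\in X}xx^*=1$. For an automaton $A\subseteq G$ define equivalence relations $\equiv_w$ on $A$, $w\in X^*$, as follows: $\equiv_\varepsilon$ is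 equality, and $g\equiv_{xw}h$ if and only if $g(x)=h(x)$ and $g|_x\equiv_w h|_x$. More generally, for $x\in X$ and an equivalence relation $\equiv$ on $A$, let $x\cdot{\equiv}$ be the relation that relates $g$ and $h$ when $g(x)=h(x)$ and $g|_x\equiv h|_x$; thus ${\equiv_{xw}}=x\cdot{\equiv_w}$. The simplicity graph $\Sigma_A$ is the finite directed graph whose vertex set is $V=\{\equiv_w : w\in X^*\}$ and which has an edge labeled $x$ from $\equiv$ to $x\cdot{\equiv}$ for each ${\equiv}\in V$ and $x\in X$. A vertex is essential if it is reachable by a directed path from a directed cycle; let $V_{\mathrm{ess}}$ be the set of essential vertices. The strongly connected components of $\Sigma_A$ are partially ordered by $\mathcal C\le\mathcal C'$ if there is a directed path from $\mathcal C'$ to $\mathcal C$; let $V_{\min}$ be the set of vertices contained in minimal components. For ${\equiv}\in V$, let $E_{\equiv,K}$ be the homogeneous system of linear equations over $K$ in variables $c_g$ ($g\in A$) consisting of the equations $\sum_{g\equiv h}c_g=0$, one for each $h\in A$, and let $E_{S,K}=\bigcup_{{\equiv}\in V_{\min}}E_{\equiv,K}$. One system is a consequence of another if each solution in $K$ of the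 latter is a solution of the former. Theorem. Let $G$ be a contracting self-similar group over $X$, let $K$ be a field, and let $A\subseteq G$ be an automaton containing the nucleus of $G$. Then $\mathcal N_K(G,X)$ is simple if and only if $E_{\equiv,K}$ is a consequence of $E_{S,K}$ for each ${\equiv}\in V_{\mathrm{ess}}\setminus V_{\min}$. -/

import Mathlib

/-- A self-similar group over the alphabet `X`: a faithful action of the group `G` on the set
`List X` of finite words over `X` by length-preserving permutations such that for every
`g : G` and every letter `x` there is a group element `h` (the section of `g` at `x`) with
`g (x w) = g(x) h(w)` for all words `w`. -/
structure SelfSimilarAction (G X : Type*) [Group G] where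
  /-- the permutation of the set of words given by a group element -/
  toPerm : G →* Equiv.Perm (List X)
  faithful : Function.Injective toPerm
  length_map : ∀ (g : G) (w : List X), (toPerm g w).length = w.length
  exists_section : ∀ (g : G) (x : X), ∃ h : G, ∀ w : List X,
    toPerm g (x :: w) = toPerm g [x] ++ toPerm h w

namespace SelfSimilarAction

variable {G X : Type*} [Group G] (S : SelfSimilarAction G X)

theorem map_singleton_ne_nil (g : G) (x : X) : S.toPerm g [x] ≠ [] := by
  intro h
  have := S.length_map g [x]
  simp [h] at this

/-- The letter `g(x)`: the unique letter of the word `g` applied to the one-letter word `x`. -/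
def letter (g : G) (x : X) : X := (S.toPerm g [x]).head (S.map_singleton_ne_nil g x)

/-- The section `g|_x` of `g` at the letter `x` (unique, since the action is faithful). -/
noncomputable def sec (g : G) (x : X) : G := Classical.choose (S.exists_section g x)

theorem map_cons (g : G) (x : X) (w : List X) :
    S.toPerm g (x :: w) = S.letter g x :: S.toPerm (S.sec g x) w := by
  have h1 : S.toPerm g (x :: w) = S.toPerm g [x] ++ S.toPerm (S.sec g x) w :=
    Classical.choose_spec (S.exists_section g x) w
  have h2 : S.toPerm g [x] = [S.letter g x] := by
    obtain ⟨a, ha⟩ := List.length_eq_one_iff.1 (S.length_map g [x])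
    simp [letter, ha]
  rw [h1, h2]
  rfl

theorem sec_eq_of_forall {g h : G} {x : X}
    (hh : ∀ w : List X, S.toPerm g (x :: w) = S.letter g x :: S.toPerm h w) :
    S.sec g x = h := by
  apply S.faithful
  ext1 w
  have := (S.map_cons g x w).symm.trans (hh w)
  simpa using this

/-- The section `g|_w` at a word, with `g|_{xv} = (g|_x)|_v`. -/
noncomputable def secWord (g : G) : List X → G
  | [] => g
  | x :: v => secWord (S.sec g x) v

theorem secWord_append (g : G) (u v : List X) :
    S.secWord g (u ++ v) = S.secWord (S.secWord g u) v := by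
  induction u generalizing g with
  | nil => rfl
  | cons x u ih => exact ih (S.sec g x)

/-- A set of group elements is closed under taking sections. -/
def SectionClosed (N : Set G) : Prop := ∀ g ∈ N, ∀ x : X, S.sec g x ∈ N

/-- `N` is a finite set of group elements, closed under taking sections, such that every
`g : G` has some level `n` at which all its sections lie in `N`. -/
def IsAttracting (N : Set G) : Prop :=
  N.Finite ∧ S.SectionClosed N ∧
    ∀ g : G, ∃ n : ℕ, ∀ w : List X, w.length = n → S.secWord g w ∈ N

/-- The self-similar group is contracting. -/
def IsContracting : Prop := ∃ N : Set G, S.IsAttracting N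

/-- The nucleus: the smallest attracting set (see `nucleus_isLeast`). -/
def nucleus : Set G := ⋂₀ {N : Set G | S.IsAttracting N}

theorem SectionClosed.secWord_mem {N : Set G} (hN : S.SectionClosed N) {g : G} (hg : g ∈ N)
    (w : List X) : S.secWord g w ∈ N := by
  induction w generalizing g with
  | nil => exact hg
  | cons x w ih => exact ih (hN g hg x)

theorem IsAttracting.inter {N N' : Set G} (h : S.IsAttracting N) (h' : S.IsAttracting N') :
    S.IsAttracting (N ∩ N') := by
  refine ⟨h.1.inter_of_left _, fun g hg x => ⟨h.2.1 g hg.1 x, h'.2.1 g hg.2 x⟩, fun g => ?_⟩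
  obtain ⟨n, hn⟩ := h.2.2 g
  obtain ⟨m, hm⟩ := h'.2.2 g
  refine ⟨n + m, fun w hw => ⟨?_, ?_⟩⟩
  · rw [← List.take_append_drop n w, secWord_append]
    exact h.2.1.secWord_mem S (hn _ (by simp [hw])) _
  · rw [← List.take_append_drop m w, secWord_append]
    exact h'.2.1.secWord_mem S (hm _ (by simp [hw])) _

/-- In a contracting group the nucleus is indeed the smallest attracting set. -/
theorem nucleus_isLeast (h : S.IsContracting) :
    IsLeast {N : Set G | S.IsAttracting N} S.nucleus := by
  classical
  have hex : ∃ k : ℕ, ∃ N : Set G, S.IsAttracting N ∧ N.ncard = k := by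
    obtain ⟨N, hN⟩ := h
    exact ⟨_, N, hN, rfl⟩
  obtain ⟨N, hN, hk⟩ := Nat.find_spec hex
  have hmin : ∀ N', S.IsAttracting N' → N ⊆ N' := by
    intro N' hN'
    have hle : N.ncard ≤ (N ∩ N').ncard := by
      rw [hk]
      exact Nat.find_min' hex ⟨_, hN.inter S hN', rfl⟩
    exact Set.inter_eq_left.1 (Set.eq_of_subset_of_ncard_le Set.inter_subset_left hle hN.1)
  have hNeq : S.nucleus = N :=
    Set.Subset.antisymm (Set.sInter_subset_of_mem hN) (Set.subset_sInter hmin)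
  rw [hNeq]
  exact ⟨hN, fun N' hN' => hmin N' hN'⟩

end SelfSimilarAction

/-- The generators of the Nekrashevych algebra as an algebra: the letters `x`, the group
elements `g`, and their formal adjoints. -/
inductive NekGen (G X : Type*)
  | letter (x : X)
  | letterStar (x : X)
  | elt (g : G)
  | eltStar (g : G)

namespace SelfSimilarAction

variable {G X : Type*} [Group G]

/-- The defining relations of the Nekrashevych algebra, in the free algebra on the letters and
group elements and their adjoints. The identity of the group is the identity of the algebra.
Up to `elt_star` the list is closed under the involution that exchanges every generator with
its adjoint and reverses products. -/
inductive NekRel (K : Type*) [Field K] [Fintype X] (S : SelfSimilarAction G X) :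
    FreeAlgebra K (NekGen G X) → FreeAlgebra K (NekGen G X) → Prop
  | elt_star (g : G) :
      NekRel K S (FreeAlgebra.ι K (.eltStar g)) (FreeAlgebra.ι K (.elt g⁻¹))
  | elt_mul (g h : G) :
      NekRel K S (FreeAlgebra.ι K (.elt g) * FreeAlgebra.ι K (.elt h))
        (FreeAlgebra.ι K (.elt (g * h)))
  | elt_one : NekRel K S (FreeAlgebra.ι K (.elt 1)) 1
  | ss (g : G) (x : X) :
      NekRel K S (FreeAlgebra.ι K (.elt g) * FreeAlgebra.ι K (.letter x))
        (FreeAlgebra.ι K (.letter (S.letter g x)) * FreeAlgebra.ι K (.elt (S.sec g x)))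
  | ss_star (g : G) (x : X) :
      NekRel K S (FreeAlgebra.ι K (.letterStar x) * FreeAlgebra.ι K (.eltStar g))
        (FreeAlgebra.ι K (.eltStar (S.sec g x)) * FreeAlgebra.ι K (.letterStar (S.letter g x)))
  | ck1_same (x : X) :
      NekRel K S (FreeAlgebra.ι K (.letterStar x) * FreeAlgebra.ι K (.letter x)) 1
  | ck1_ne (x y : X) (hxy : x ≠ y) :
      NekRel K S (FreeAlgebra.ι K (.letterStar y) * FreeAlgebra.ι K (.letter x)) 0
  | ck2 :
      NekRel K S (∑ x : X, FreeAlgebra.ι K (.letter x) * FreeAlgebra.ι K (.letterStar x)) 1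

/-- The Nekrashevych algebra of a self-similar group with coefficients in the field `K`. -/
def NekAlgebra (K : Type*) [Field K] [Fintype X] (S : SelfSimilarAction G X) : Type _ :=
  RingQuot (NekRel K S)

noncomputable instance (K : Type*) [Field K] [Fintype X] (S : SelfSimilarAction G X) :
    Ring (NekAlgebra K S) := inferInstanceAs (Ring (RingQuot (NekRel K S)))

noncomputable instance (K : Type*) [Field K] [Fintype X] (S : SelfSimilarAction G X) :
    Algebra K (NekAlgebra K S) := inferInstanceAs (Algebra K (RingQuot (NekRel K S)))

/-- A finite automaton in a self-similar group: a finite set of group elements, its states,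
closed under taking sections. -/
structure Automaton (S : SelfSimilarAction G X) where
  states : Finset G
  sectionClosed : S.SectionClosed (states : Set G)

namespace Automaton

variable {S : SelfSimilarAction G X} (A : Automaton S)

/-- The section of a state at a letter, as a state. -/
noncomputable def next (g : A.states) (x : X) : A.states :=
  ⟨S.sec g x, A.sectionClosed g g.2 x⟩

/-- The action of a letter on equivalence relations on the automaton:
`g` and `h` are related by `x · r` if `g(x) = h(x)` and `g|_x`, `h|_x` are related by `r`. -/
def dot (x : X) (r : Setoid A.states) : Setoid A.states where
  r g h := S.letter g x = S.letter h x ∧ r (A.next g x) (A.next h x)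
  iseqv :=
    ⟨fun _ => ⟨rfl, r.refl _⟩, fun h => ⟨h.1.symm, r.symm h.2⟩,
      fun h h' => ⟨h.1.trans h'.1, r.trans h.2 h'.2⟩⟩

/-- The relation `≡_w` : for the empty word it is equality, and `≡_{xw} = x · ≡_w`. -/
def eqv : List X → Setoid A.states
  | [] => ⊥
  | x :: w => A.dot x (eqv w)

/-- The vertices of the simplicity graph: the equivalence relations `≡_w`. -/
@[ext]
structure Vertex where
  rel : Setoid A.states
  exists_word : ∃ w : List X, rel = A.eqv w

/-- There is an edge of the simplicity graph from `v` to `v'`: for some letter `x`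
(the label of the edge), `v' = x · v`. -/
def Edge (v v' : A.Vertex) : Prop := ∃ x : X, v'.rel = A.dot x v.rel

/-- There is a directed path (possibly of length zero) from `v` to `v'`. -/
def Reaches (v v' : A.Vertex) : Prop := Relation.ReflTransGen A.Edge v v'

/-- The reachability preorder: `v ≤ v'` if there is a directed path from `v'` to `v`. -/
instance : Preorder A.Vertex where
  le v v' := A.Reaches v' v
  le_refl _ := Relation.ReflTransGen.refl
  le_trans _ _ _ h h' := Relation.ReflTransGen.trans h' h

/-- The strongly connected components of the simplicity graph (classes of mutually reachable
vertices), partially ordered by reachability. -/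
abbrev Component : Type _ := Antisymmetrization A.Vertex (· ≤ ·)

/-- The strongly connected component of a vertex. -/
def component (v : A.Vertex) : A.Component := toAntisymmetrization (· ≤ ·) v

/-- The set of vertices that belong to minimal strongly connected components. -/
def Vmin : Set A.Vertex := {v | IsMin (A.component v)}

/-- The set of essential vertices: those reachable from a directed cycle. -/
def Vess : Set A.Vertex := {v | ∃ u : A.Vertex, Relation.TransGen A.Edge u u ∧ A.Reaches u v}

open Classical in
/-- The homogeneous system of linear equations `∑_{g ≡ h} c_g = 0`, one for each state `h`,
over the integers in the variables `c_g`; an equation is given by its coefficient vector. -/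
noncomputable def system (r : Setoid A.states) : Set (A.states → ℤ) :=
  {f | ∃ h : A.states, f = fun g => if r g h then 1 else 0}

/-- The union of the systems of all vertices in minimal strongly connected components. -/
noncomputable def systemS : Set (A.states → ℤ) := ⋃ v ∈ A.Vmin, A.system v.rel

end Automaton

end SelfSimilarAction

/-- `c` solves, over the field `K`, the homogeneous system `E` of integer linear equations. -/
def IsSolution {ι : Type*} [Fintype ι] {K : Type*} [Field K] (E : Set (ι → ℤ)) (c : ι → K) :
    Prop :=
  ∀ f ∈ E, ∑ i, (f i : K) * c i = 0

/-- The system `E'` is a consequence of the system `E` over `K`: every solution of `E` with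
values in `K` is a solution of `E'`. -/
def IsConsequence {ι : Type*} [Fintype ι] (K : Type*) [Field K] (E' E : Set (ι → ℤ)) : Prop :=
  ∀ c : ι → K, IsSolution E c → IsSolution E' c

namespace SelfSimilarAction

/-! Call b singular if every word p has an extension p s with b p s = 0. The singular elements form
a proper two-sided ideal (`singularIdeal`), so in a simple algebra only 0 is singular. Conversely
(`isSimpleRing_of_forall_isSingular`), an ideal with a nonsingular element contains the value of a
formal sum ∑ c_{u,g} u g annihilated by no word. Take one with the fewest terms. Appending words and
removing prefixes can then neither merge nor lose terms, so the words u g(s) agree over all terms,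
for every s. By |X| ≥ 2 and faithfulness there is a single term, which is left invertible.

Simplicity therefore means that no nonzero element is singular. In the contracting case it suffices
to test f = ∑ c_g g with g in A (`eq_zero_of_isSingular_of_contracting`): long words push all group
elements into the nucleus, word lengths can be separated, and the words on the left can be stripped.

Since g w = g(w) g|_w, the coefficients of f w are the sums of c over the classes of ≡_w; so f w
vanishes formally exactly when c solves the system of ≡_w (`isSolution_system_eqv_iff`). Now f is
singular iff c solves the systems of the minimal vertices (`isSingular_eval_formalSum`,
`isSolution_systemS_of_isSingular`), and f = 0 iff c solves the systems of ≡_w for all long w, which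
amounts to all essential vertices.

The last equivalence needs the word problem `eval_eq_zero_iff`: a sum that is zero in the algebra
vanishes formally after long words. This comes from a representation on germs at infinity of
families of formal sums. -/

theorem eq_of_take_append_eq {X : Type*} {a b c d : List X} {n : ℕ}
    (h : (a ++ b).take n = (c ++ d).take n) (hl : a.length = c.length) (hn : a.length ≤ n) :
    a = c := by
  have := congrArg (List.take a.length) h
  rwa [List.take_take, List.take_take, min_eq_left hn, List.take_left' rfl,
    List.take_left' hl.symm] at this

/-! ### Formal sums of pairs (word, group element) -/

section FormalSums

variable {G X K : Type*} [Field K]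

/-- The part of a formal sum that is carried by the words of length `d`. -/
noncomputable def lengthPart (d : ℕ) (f : List X × G →₀ K) : List X × G →₀ K :=
  f.filter fun p => p.1.length = d

theorem lengthPart_zero (d : ℕ) : lengthPart d (0 : List X × G →₀ K) = 0 := by
  ext p
  simp [lengthPart, Finsupp.filter_apply]

theorem lengthPart_add (d : ℕ) (f g : List X × G →₀ K) :
    lengthPart d (f + g) = lengthPart d f + lengthPart d g :=
  Finsupp.filter_add

theorem lengthPart_single (d : ℕ) (u : List X) (g : G) (c : K) :
    lengthPart d (Finsupp.single (u, g) c) =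
      if u.length = d then Finsupp.single (u, g) c else 0 := by
  split_ifs with h
  · exact Finsupp.filter_single_of_pos (fun p : List X × G => p.1.length = d) h
  · exact Finsupp.filter_single_of_neg (fun p : List X × G => p.1.length = d) h

theorem sum_lengthPart (f : List X × G →₀ K) :
    ∑ d ∈ f.support.image fun p => p.1.length, lengthPart d f = f := by
  classical
  ext p
  simp only [Finsupp.finsetSum_apply, lengthPart, Finsupp.filter_apply, Finset.sum_ite_eq]
  split_ifs with h
  · rfl
  · by_contra hp
    exact h (Finset.mem_image_of_mem (fun p : List X × G => p.1.length)
      (Finsupp.mem_support_iff.2 (Ne.symm hp)))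

end FormalSums

section FreeModule

variable {G X : Type*} (K : Type*) [Field K]

/-- Prepending a letter: `(u, g) ↦ (xu, g)`, extended linearly. -/
noncomputable def consLeft (x : X) : (List X × G →₀ K) →ₗ[K] (List X × G →₀ K) :=
  Finsupp.lmapDomain K K fun p => (x :: p.1, p.2)

theorem prepend_injective (q : List X) :
    Function.Injective fun p : List X × G => (q ++ p.1, p.2) := by
  rintro ⟨u, g⟩ ⟨v, h⟩ e
  simpa using e

/-- Removing the prefix `q`; basis elements whose word does not begin with `q` are killed. -/
noncomputable def stripLeft (q : List X) : (List X × G →₀ K) →ₗ[K] (List X × G →₀ K) :=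
  Finsupp.lcomapDomain _ (prepend_injective q)

@[simp] theorem consLeft_single (x : X) (u : List X) (g : G) (c : K) :
    consLeft K x (Finsupp.single (u, g) c) = Finsupp.single (x :: u, g) c := by
  simp [consLeft, Finsupp.mapDomain_single]

theorem stripLeft_apply (q : List X) (f : List X × G →₀ K) (p : List X × G) :
    stripLeft K q f p = f (q ++ p.1, p.2) := rfl

theorem stripLeft_single_append (q u : List X) (g : G) (c : K) :
    stripLeft K q (Finsupp.single (q ++ u, g) c) = Finsupp.single (u, g) c := by
  classical
  ext ⟨v, h⟩
  simp [stripLeft_apply, Finsupp.single_apply]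

theorem stripLeft_single_of_not_prefix {q u : List X} (hq : ¬ q <+: u) (g : G) (c : K) :
    stripLeft K q (Finsupp.single (u, g) c) = 0 := by
  classical
  ext ⟨v, h⟩
  rw [stripLeft_apply, Finsupp.single_apply, if_neg]
  · rfl
  · rintro e
    exact hq ⟨v, (congrArg Prod.fst e).symm⟩

/-- The formal counterpart of ∑ x x* = 1. It fails on terms with the empty word, which stripping
kills. -/
theorem sum_consLeft_stripLeft [Fintype X] {f : List X × G →₀ K}
    (hf : ∀ p ∈ f.support, 1 ≤ p.1.length) :
    ∑ x : X, consLeft K x (stripLeft K [x] f) = f := by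
  classical
  have key : ∀ (x : X) (p : List X × G), consLeft K x (stripLeft K [x] f) p =
      if p.1.head? = some x then f p else 0 := by
    rintro x ⟨u, g⟩
    rw [consLeft, Finsupp.lmapDomain_apply]
    split_ifs with h
    · obtain ⟨v, rfl⟩ : ∃ v, u = x :: v := by
        cases u with
        | nil => simp at h
        | cons y v => simp at h; exact ⟨v, by rw [h]⟩
      exact Finsupp.mapDomain_apply (prepend_injective [x]) _ (v, g)
    · apply Finsupp.mapDomain_of_notMem_range
      rintro ⟨p, hp⟩
      apply h
      obtain rfl : x :: p.1 = u := congrArg Prod.fst hp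
      rfl
  ext ⟨u, g⟩
  simp only [Finsupp.finsetSum_apply, key]
  cases u with
  | nil =>
    have : f ([], g) = 0 := by
      by_contra h
      simpa using hf _ (Finsupp.mem_support_iff.2 h)
    simp [this]
  | cons y v => simp

theorem card_support_stripLeft_le (q : List X) (f : List X × G →₀ K) :
    (stripLeft K q f).support.card ≤ f.support.card := by
  apply Finset.card_le_card_of_injOn (fun p => (q ++ p.1, p.2))
  · intro p hp
    simpa [stripLeft_apply] using hp
  · exact (prepend_injective q).injOn

/-- Stripping is injective on the terms it keeps, so equal cardinalities mean that no term was
killed. -/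
theorem prefix_of_card_support_stripLeft (q : List X) (f : List X × G →₀ K)
    (h : (stripLeft K q f).support.card = f.support.card)
    {p : List X × G} (hp : p ∈ f.support) : q <+: p.1 := by
  classical
  have h1 : (stripLeft K q f).support.image (fun p => (q ++ p.1, p.2)) = f.support := by
    apply Finset.eq_of_subset_of_card_le
    · intro p hp
      obtain ⟨p', hp', rfl⟩ := Finset.mem_image.1 hp
      simpa [stripLeft_apply] using hp'
    · rw [Finset.card_image_of_injective _ (prepend_injective q), h]
  rw [← h1] at hp
  obtain ⟨p', -, rfl⟩ := Finset.mem_image.1 hp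
  exact ⟨p'.1, rfl⟩

end FreeModule

variable {G X : Type*} [Group G] (S : SelfSimilarAction G X)

/-! ### Sections of products, and formal multiplication by words and group elements -/

section Sections

theorem toPerm_nil (g : G) : S.toPerm g [] = [] :=
  List.length_eq_zero_iff.1 (S.length_map g [])

theorem toPerm_singleton (g : G) (x : X) : S.toPerm g [x] = [S.letter g x] := by
  rw [S.map_cons, S.toPerm_nil]

theorem toPerm_append (g : G) (u w : List X) :
    S.toPerm g (u ++ w) = S.toPerm g u ++ S.toPerm (S.secWord g u) w := by
  induction u generalizing g with
  | nil => simp [toPerm_nil, secWord]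
  | cons x u ih => simp [map_cons, ih, secWord]

theorem letter_injective (g : G) : Function.Injective (S.letter g) := by
  intro x y h
  have : S.toPerm g [x] = S.toPerm g [y] := by rw [toPerm_singleton, toPerm_singleton, h]
  simpa using (S.toPerm g).injective this

theorem letter_mul (g h : G) (x : X) : S.letter (g * h) x = S.letter g (S.letter h x) := by
  have := S.toPerm_singleton (g * h) x
  rw [map_mul, Equiv.Perm.mul_apply, toPerm_singleton, toPerm_singleton] at this
  simpa using this.symm

theorem sec_mul (g h : G) (x : X) :
    S.sec (g * h) x = S.sec g (S.letter h x) * S.sec h x := by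
  apply S.sec_eq_of_forall
  intro w
  rw [letter_mul, map_mul, Equiv.Perm.mul_apply, map_cons, map_cons, map_mul,
    Equiv.Perm.mul_apply]

theorem letter_one (x : X) : S.letter 1 x = x := by
  simpa using (S.toPerm_singleton 1 x).symm

theorem sec_one (x : X) : S.sec 1 x = 1 := by
  apply S.sec_eq_of_forall
  simp [letter_one]

theorem secWord_one (w : List X) : S.secWord 1 w = 1 := by
  induction w with
  | nil => rfl
  | cons x w ih => rw [secWord, sec_one, ih]

theorem secWord_mul (g h : G) (w : List X) :
    S.secWord (g * h) w = S.secWord g (S.toPerm h w) * S.secWord h w := by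
  induction w generalizing g h with
  | nil => simp [toPerm_nil, secWord]
  | cons x w ih => rw [secWord, sec_mul, ih, map_cons, secWord, secWord]

theorem exists_forall_secWord_mem {N : Set G} (hN : S.IsAttracting N) (B : Finset G) :
    ∃ n : ℕ, ∀ g ∈ B, ∀ w : List X, n ≤ w.length → S.secWord g w ∈ N := by
  classical
  induction B using Finset.induction with
  | empty => exact ⟨0, by simp⟩
  | insert a B _ ih =>
    obtain ⟨n, hn⟩ := ih
    obtain ⟨m, hm⟩ := hN.2.2 a
    refine ⟨max n m, fun g hg w hw => ?_⟩
    rcases Finset.mem_insert.1 hg with rfl | hg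
    · rw [← List.take_append_drop m w, secWord_append]
      exact hN.2.1.secWord_mem S (hm _ (by simp; omega)) _
    · exact hn g hg w (by omega)

end Sections

section Formal

variable (K : Type*) [Field K]

/-- Appending a word on the right: `(u, g) ↦ (u g(s), g|_s)`, extended linearly. -/
noncomputable def appendRight (s : List X) :
    (List X × G →₀ K) →ₗ[K] (List X × G →₀ K) :=
  Finsupp.lmapDomain K K fun p => (p.1 ++ S.toPerm p.2 s, S.secWord p.2 s)

/-- Left multiplication by a group element: `(u, h) ↦ (g(u), g|_u h)`, extended linearly. -/
noncomputable def actLeft (g : G) : (List X × G →₀ K) →ₗ[K] (List X × G →₀ K) :=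
  Finsupp.lmapDomain K K fun p => (S.toPerm g p.1, S.secWord g p.1 * p.2)

@[simp] theorem appendRight_single (s u : List X) (g : G) (c : K) :
    S.appendRight K s (Finsupp.single (u, g) c) =
      Finsupp.single (u ++ S.toPerm g s, S.secWord g s) c := by
  simp [appendRight, Finsupp.mapDomain_single]

@[simp] theorem actLeft_single (g : G) (u : List X) (h : G) (c : K) :
    S.actLeft K g (Finsupp.single (u, h) c) =
      Finsupp.single (S.toPerm g u, S.secWord g u * h) c := by
  simp [actLeft, Finsupp.mapDomain_single]

theorem appendRight_append (s t : List X) (f : List X × G →₀ K) :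
    S.appendRight K (s ++ t) f = S.appendRight K t (S.appendRight K s f) := by
  induction f using Finsupp.induction_linear with
  | zero => simp
  | add f g hf hg => simp [hf, hg]
  | single p c => obtain ⟨u, h⟩ := p; simp [toPerm_append, secWord_append]

theorem consLeft_appendRight (x : X) (s : List X) (f : List X × G →₀ K) :
    consLeft K x (S.appendRight K s f) = S.appendRight K s (consLeft K x f) := by
  induction f using Finsupp.induction_linear with
  | zero => simp
  | add f g hf hg => simp [hf, hg]
  | single p c => obtain ⟨u, h⟩ := p; simp

theorem actLeft_appendRight (g : G) (s : List X) (f : List X × G →₀ K) :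
    S.actLeft K g (S.appendRight K s f) = S.appendRight K s (S.actLeft K g f) := by
  induction f using Finsupp.induction_linear with
  | zero => simp
  | add f g hf hg => simp [hf, hg]
  | single p c =>
    obtain ⟨u, h⟩ := p
    simp [toPerm_append, secWord_append, secWord_mul]

theorem support_appendRight_subset (s : List X) (f : List X × G →₀ K)
    {p : List X × G} (hp : p ∈ (S.appendRight K s f).support) :
    ∃ p' ∈ f.support, p = (p'.1 ++ S.toPerm p'.2 s, S.secWord p'.2 s) := by
  classical
  obtain ⟨p', h, rfl⟩ := Finset.mem_image.1 (Finsupp.mapDomain_support hp)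
  exact ⟨p', h, rfl⟩

theorem le_length_of_mem_support_appendRight (m : ℕ) (s : List X) (hs : m ≤ s.length)
    (f : List X × G →₀ K) : ∀ p ∈ (S.appendRight K s f).support, m ≤ p.1.length := by
  intro p hp
  obtain ⟨p', -, rfl⟩ := S.support_appendRight_subset K s f hp
  simp [S.length_map]
  omega

theorem card_support_appendRight_le (s : List X) (f : List X × G →₀ K) :
    (S.appendRight K s f).support.card ≤ f.support.card := by
  classical
  exact (Finset.card_le_card Finsupp.mapDomain_support).trans Finset.card_image_le

/-- Terms may merge or cancel under appending; with equal cardinalities the support is exactly the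
image of the old one. -/
theorem mem_support_appendRight (s : List X) (f : List X × G →₀ K)
    (h : (S.appendRight K s f).support.card = f.support.card)
    {p : List X × G} (hp : p ∈ f.support) :
    (p.1 ++ S.toPerm p.2 s, S.secWord p.2 s) ∈ (S.appendRight K s f).support := by
  classical
  have h1 := Finset.eq_of_subset_of_card_le (Finsupp.mapDomain_support (s := f)
    (f := fun p : List X × G => (p.1 ++ S.toPerm p.2 s, S.secWord p.2 s)))
    (Finset.card_image_le.trans h.ge)
  exact h1 ▸ Finset.mem_image_of_mem _ hp

end Formal

end SelfSimilarAction

/-! ### Calculus in the Nekrashevych algebra -/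

namespace SelfSimilarAction

variable {G X : Type*} [Group G] [Fintype X] (K : Type*) [Field K] (S : SelfSimilarAction G X)

namespace NekAlgebra

/-- The quotient map from the free algebra to the Nekrashevych algebra. -/
noncomputable def mk : FreeAlgebra K (NekGen G X) →ₐ[K] NekAlgebra K S :=
  RingQuot.mkAlgHom K (NekRel K S)

theorem mk_surjective : Function.Surjective (mk K S) :=
  RingQuot.mkAlgHom_surjective K (NekRel K S)

theorem mk_eq {a b : FreeAlgebra K (NekGen G X)} (h : NekRel K S a b) : mk K S a = mk K S b :=
  RingQuot.mkAlgHom_rel K h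

/-- The image of a letter. -/
noncomputable def letter (x : X) : NekAlgebra K S := mk K S (FreeAlgebra.ι K (.letter x))

/-- The image of the adjoint of a letter. -/
noncomputable def star (x : X) : NekAlgebra K S := mk K S (FreeAlgebra.ι K (.letterStar x))

/-- The image of a group element. -/
noncomputable def elt (g : G) : NekAlgebra K S := mk K S (FreeAlgebra.ι K (.elt g))

theorem eltStar_eq (g : G) : mk K S (FreeAlgebra.ι K (.eltStar g)) = elt K S g⁻¹ :=
  mk_eq K S (.elt_star g)

theorem elt_mul (g h : G) : elt K S g * elt K S h = elt K S (g * h) := by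
  rw [elt, elt, ← map_mul]; exact mk_eq K S (.elt_mul g h)

theorem elt_one : elt K S 1 = 1 := by
  rw [← map_one (mk K S)]; exact mk_eq K S .elt_one

theorem elt_mul_letter (g : G) (x : X) :
    elt K S g * letter K S x = letter K S (S.letter g x) * elt K S (S.sec g x) := by
  simp only [elt, letter, ← map_mul]; exact mk_eq K S (.ss g x)

theorem star_mul_letter_self (x : X) : star K S x * letter K S x = 1 := by
  rw [star, letter, ← map_mul, ← map_one (mk K S)]; exact mk_eq K S (.ck1_same x)

theorem star_mul_letter_of_ne {x y : X} (h : x ≠ y) : star K S y * letter K S x = 0 := by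
  rw [star, letter, ← map_mul, ← map_zero (mk K S)]; exact mk_eq K S (.ck1_ne x y h)

theorem sum_letter_mul_star : ∑ x : X, letter K S x * star K S x = 1 := by
  simp only [star, letter, ← map_mul, ← map_sum]
  rw [← map_one (mk K S)]; exact mk_eq K S .ck2

/-- Induction over the elements of the Nekrashevych algebra; the adjoints of group elements need
no case of their own. -/
theorem induction {C : NekAlgebra K S → Prop} (add : ∀ a b, C a → C b → C (a + b))
    (mul : ∀ a b, C a → C b → C (a * b)) (scalar : ∀ c : K, C (algebraMap K _ c))
    (letter : ∀ x, C (letter K S x)) (star : ∀ x, C (star K S x)) (elt : ∀ g, C (elt K S g))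
    (a : NekAlgebra K S) : C a := by
  obtain ⟨a, rfl⟩ := mk_surjective K S a
  induction a using FreeAlgebra.induction with
  | grade0 c => rw [AlgHom.commutes]; exact scalar c
  | grade1 y =>
    cases y with
    | letter x => exact letter x
    | letterStar x => exact star x
    | elt g => exact elt g
    | eltStar g => rw [eltStar_eq]; exact elt _
  | mul a b ha hb => rw [map_mul]; exact mul _ _ ha hb
  | add a b ha hb => rw [map_add]; exact add _ _ ha hb

/-- The product of the letters of a word. -/
noncomputable def word (w : List X) : NekAlgebra K S := (w.map (letter K S)).prod

/-- The adjoint of a word. -/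
noncomputable def wordStar (w : List X) : NekAlgebra K S := (w.reverse.map (star K S)).prod

@[simp] theorem word_nil : word K S [] = 1 := rfl

theorem word_cons (x : X) (w : List X) : word K S (x :: w) = letter K S x * word K S w := by
  simp [word]

theorem word_append (u w : List X) : word K S (u ++ w) = word K S u * word K S w := by
  simp [word]

@[simp] theorem wordStar_nil : wordStar K S [] = 1 := rfl

theorem wordStar_cons (x : X) (w : List X) :
    wordStar K S (x :: w) = wordStar K S w * star K S x := by
  simp [wordStar]

theorem wordStar_append (u w : List X) :
    wordStar K S (u ++ w) = wordStar K S w * wordStar K S u := by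
  simp [wordStar]

theorem wordStar_mul_word_self (w : List X) : wordStar K S w * word K S w = 1 := by
  induction w with
  | nil => simp
  | cons x w ih =>
    rw [wordStar_cons, word_cons, mul_assoc, ← mul_assoc (star K S x), star_mul_letter_self,
      one_mul, ih]

theorem wordStar_mul_word_of_ne {u w : List X} (hl : u.length = w.length) (hne : u ≠ w) :
    wordStar K S u * word K S w = 0 := by
  induction u generalizing w with
  | nil =>
    cases w with
    | nil => exact absurd rfl hne
    | cons => simp at hl
  | cons x u ih =>
    cases w with
    | nil => simp at hl
    | cons y w =>
      rw [wordStar_cons, word_cons, mul_assoc, ← mul_assoc (star K S x)]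
      by_cases hxy : y = x
      · subst hxy
        rw [star_mul_letter_self, one_mul]
        exact ih (by simpa using hl) (by simpa using hne)
      · rw [star_mul_letter_of_ne K S hxy, zero_mul, mul_zero]

theorem elt_mul_word (g : G) (w : List X) :
    elt K S g * word K S w = word K S (S.toPerm g w) * elt K S (S.secWord g w) := by
  induction w generalizing g with
  | nil => simp [toPerm_nil, secWord]
  | cons x w ih =>
    rw [word_cons, ← mul_assoc, elt_mul_letter, mul_assoc, ih, map_cons, word_cons, mul_assoc]
    rfl

variable {K S}

theorem eq_zero_of_mul_letter {b : NekAlgebra K S} (h : ∀ x, b * letter K S x = 0) : b = 0 := by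
  rw [← mul_one b, ← sum_letter_mul_star, Finset.mul_sum]
  exact Finset.sum_eq_zero fun x _ => by rw [← mul_assoc, h, zero_mul]

theorem eq_zero_of_mul_word (n : ℕ) {b : NekAlgebra K S}
    (h : ∀ w : List X, w.length = n → b * word K S w = 0) : b = 0 := by
  induction n generalizing b with
  | zero => simpa using h [] rfl
  | succ n ih =>
    refine eq_zero_of_mul_letter fun x => ih fun w hw => ?_
    rw [mul_assoc, ← word_cons]
    exact h _ (by simp [hw])

variable (K S)

/-- The element `∑ c_{u,g} u g` of the algebra given by a finitely supported `c`. -/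
noncomputable def eval : (List X × G →₀ K) →ₗ[K] NekAlgebra K S :=
  Finsupp.linearCombination K fun p => word K S p.1 * elt K S p.2

@[simp] theorem eval_single (u : List X) (g : G) (c : K) :
    eval K S (Finsupp.single (u, g) c) = c • (word K S u * elt K S g) := by
  simp [eval]

theorem eval_appendRight (s : List X) (f : List X × G →₀ K) :
    eval K S (S.appendRight K s f) = eval K S f * word K S s := by
  induction f using Finsupp.induction_linear with
  | zero => simp
  | add f g hf hg => simp [hf, hg, add_mul]
  | single p c =>
    obtain ⟨u, h⟩ := p
    simp [word_append, mul_assoc, elt_mul_word]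

theorem eval_consLeft (x : X) (f : List X × G →₀ K) :
    eval K S (consLeft K x f) = letter K S x * eval K S f := by
  induction f using Finsupp.induction_linear with
  | zero => simp
  | add f g hf hg => simp [hf, hg, mul_add]
  | single p c =>
    obtain ⟨u, h⟩ := p
    simp [word_cons, mul_assoc]

theorem eval_actLeft (g : G) (f : List X × G →₀ K) :
    eval K S (S.actLeft K g f) = elt K S g * eval K S f := by
  induction f using Finsupp.induction_linear with
  | zero => simp
  | add f g hf hg => simp [hf, hg, mul_add]
  | single p c =>
    obtain ⟨u, h⟩ := p
    simp [← elt_mul, ← mul_assoc, elt_mul_word]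

/-- The length bound is needed because q* u need not be zero when u is a proper prefix of q, whereas
stripping gives zero. -/
theorem eval_stripLeft (q : List X) (f : List X × G →₀ K)
    (hf : ∀ p ∈ f.support, q.length ≤ p.1.length) :
    eval K S (stripLeft K q f) = wordStar K S q * eval K S f := by
  classical
  have key : ∀ p ∈ f.support, eval K S (stripLeft K q (Finsupp.single p (f p))) =
      wordStar K S q * eval K S (Finsupp.single p (f p)) := by
    rintro ⟨u, g⟩ hp
    by_cases h : q <+: u
    · obtain ⟨v, rfl⟩ := h
      rw [stripLeft_single_append, eval_single, eval_single, word_append, mul_smul_comm,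
        mul_assoc, ← mul_assoc (wordStar K S q), wordStar_mul_word_self, one_mul]
    · rw [stripLeft_single_of_not_prefix K h, map_zero, eval_single, mul_smul_comm]
      have hl := hf _ hp
      rw [← List.take_append_drop q.length u, word_append, mul_assoc,
        ← mul_assoc (wordStar K S q), wordStar_mul_word_of_ne, zero_mul, smul_zero]
      · simpa using hl
      · intro e
        exact h (e ▸ List.take_prefix _ _)
  conv_lhs => rw [← Finsupp.sum_single f]
  conv_rhs => rw [← Finsupp.sum_single f]
  simp only [Finsupp.sum, map_sum, Finset.mul_sum]
  exact Finset.sum_congr rfl key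

theorem eval_eq_zero_of_appendRight {n : ℕ} {f : List X × G →₀ K}
    (h : ∀ w : List X, w.length = n → S.appendRight K w f = 0) : eval K S f = 0 :=
  eq_zero_of_mul_word n fun w hw => by rw [← eval_appendRight, h w hw, map_zero]

/-- Multiplied by long words, an element of the algebra takes the form `∑ c_{u,g} u g`. -/
theorem exists_mul_word_mem_range (b : NekAlgebra K S) :
    ∃ n : ℕ, ∀ w : List X, n ≤ w.length → ∃ f, b * word K S w = eval K S f := by
  let D : NekAlgebra K S → Prop := fun b =>
    ∃ n : ℕ, ∀ w : List X, n ≤ w.length → ∃ f, b * word K S w = eval K S f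
  -- Stability of `D` under left multiplication is what passes through products in the induction on
  -- `a`.
  suffices h : ∀ a b, D b → D (a * b) by
    rw [← mul_one b]
    exact h b 1 ⟨0, fun w _ => ⟨Finsupp.single (w, 1) 1, by simp [elt_one]⟩⟩
  intro a
  induction a using induction with
  | add a a' ha ha' =>
    intro b hb
    obtain ⟨n, hn⟩ := ha b hb
    obtain ⟨m, hm⟩ := ha' b hb
    refine ⟨max n m, fun w hw => ?_⟩
    obtain ⟨f, hf⟩ := hn w (by omega)
    obtain ⟨f', hf'⟩ := hm w (by omega)
    exact ⟨f + f', by rw [map_add, add_mul, add_mul, hf, hf']⟩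
  | mul a a' ha ha' =>
    intro b hb
    rw [mul_assoc]
    exact ha _ (ha' _ hb)
  | scalar c =>
    rintro b ⟨n, hn⟩
    refine ⟨n, fun w hw => ?_⟩
    obtain ⟨f, hf⟩ := hn w hw
    exact ⟨c • f, by rw [mul_assoc, hf, map_smul, Algebra.smul_def]⟩
  | letter x =>
    rintro b ⟨n, hn⟩
    refine ⟨n, fun w hw => ?_⟩
    obtain ⟨f, hf⟩ := hn w hw
    exact ⟨_, by rw [mul_assoc, hf, ← eval_consLeft]⟩
  | star x =>
    rintro b ⟨n, hn⟩
    -- The extra letter makes every word in the sum nonempty, so that x* acts as stripping.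
    refine ⟨n + 1, fun w hw => ?_⟩
    obtain ⟨f, hf⟩ := hn (w.take n) (by simp; omega)
    refine ⟨stripLeft K [x] (S.appendRight K (w.drop n) f), ?_⟩
    rw [eval_stripLeft, eval_appendRight, ← hf, mul_assoc b, ← word_append,
      List.take_append_drop, wordStar_cons, wordStar_nil, one_mul, mul_assoc]
    exact S.le_length_of_mem_support_appendRight K 1 _ (by simp; omega) f
  | elt g =>
    rintro b ⟨n, hn⟩
    refine ⟨n, fun w hw => ?_⟩
    obtain ⟨f, hf⟩ := hn w hw
    exact ⟨_, by rw [mul_assoc, hf, ← eval_actLeft]⟩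

end NekAlgebra

end SelfSimilarAction

/-! ### The word problem, by a representation on germs -/

namespace SelfSimilarAction

section Germs

variable {K : Type*} [Field K] {M : Type*} [AddCommGroup M] [Module K M] (X : Type*)
  (L : ℕ → Submodule K M)

/-- The families `w ↦ φ(w)` that move into every term of a filtration as the length of `w` tends
to infinity. -/
def growing : Submodule K (List X → M) where
  carrier := {φ | ∀ m : ℕ, ∃ n : ℕ, ∀ w : List X, n ≤ w.length → φ w ∈ L m}
  add_mem' := by
    intro φ ψ hφ hψ m
    obtain ⟨n, hn⟩ := hφ m
    obtain ⟨n', hn'⟩ := hψ m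
    exact ⟨max n n', fun w hw => add_mem (hn w (by omega)) (hn' w (by omega))⟩
  zero_mem' := fun m => ⟨0, fun _ _ => zero_mem _⟩
  smul_mem' := fun c φ hφ m => by
    obtain ⟨n, hn⟩ := hφ m
    exact ⟨n, fun w hw => Submodule.smul_mem _ c (hn w hw)⟩

/-- The families that vanish at all sufficiently long words. -/
def eventuallyZero : Submodule K (growing X L) where
  carrier := {φ | ∃ n : ℕ, ∀ w : List X, n ≤ w.length → φ.1 w = 0}
  add_mem' := by
    rintro φ ψ ⟨n, hn⟩ ⟨n', hn'⟩
    refine ⟨max n n', fun w hw => ?_⟩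
    change φ.1 w + ψ.1 w = 0
    rw [hn w (by omega), hn' w (by omega), add_zero]
  zero_mem' := ⟨0, fun _ _ => rfl⟩
  smul_mem' := by
    rintro c φ ⟨n, hn⟩
    refine ⟨n, fun w hw => ?_⟩
    change c • φ.1 w = 0
    rw [hn w hw, smul_zero]

/-- Germs at infinity of growing families. -/
abbrev GermModule : Type _ := growing X L ⧸ eventuallyZero X L

variable {X L}

/-- Two germs agree when the families agree at all sufficiently long words. -/
theorem germ_eq {φ ψ : growing X L}
    (h : ∃ n : ℕ, ∀ w : List X, n ≤ w.length → φ.1 w = ψ.1 w) :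
    (Submodule.Quotient.mk φ : GermModule X L) = Submodule.Quotient.mk ψ := by
  rw [Submodule.Quotient.eq]
  obtain ⟨n, hn⟩ := h
  exact ⟨n, fun w hw => sub_eq_zero.2 (hn w hw)⟩

/-- The operator on families given by a linear map that lowers the filtration by at most one. -/
def growingMap (T : M →ₗ[K] M) (hT : ∀ m, ∀ f ∈ L (m + 1), T f ∈ L m) :
    growing X L →ₗ[K] growing X L :=
  (T.compLeft (List X)).restrict (by
    intro φ hφ m
    obtain ⟨n, hn⟩ := hφ (m + 1)
    exact ⟨n, fun w hw => hT m _ (hn w hw)⟩)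

/-- The operator on germs given by a linear map that lowers the filtration by at most one. -/
def germMap (T : M →ₗ[K] M) (hT : ∀ m, ∀ f ∈ L (m + 1), T f ∈ L m) :
    GermModule X L →ₗ[K] GermModule X L :=
  Submodule.mapQ _ _ (growingMap T hT) (by
    rintro φ ⟨n, hn⟩
    refine ⟨n, fun w hw => ?_⟩
    change T (φ.1 w) = 0
    rw [hn w hw, map_zero])

theorem germMap_mk (T : M →ₗ[K] M) (hT : ∀ m, ∀ f ∈ L (m + 1), T f ∈ L m) (φ : growing X L) :
    germMap T hT (Submodule.Quotient.mk φ) = Submodule.Quotient.mk (growingMap T hT φ) := rfl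

end Germs

section Filtration

variable (G X K : Type*) [Field K]

/-- The formal sums in which all words have length at least `m`. -/
noncomputable def wordsOfLengthGe (m : ℕ) : Submodule K (List X × G →₀ K) :=
  Finsupp.supported K K {p | m ≤ p.1.length}

variable {G X K}

theorem mem_wordsOfLengthGe {m : ℕ} {f : List X × G →₀ K} :
    f ∈ wordsOfLengthGe G X K m ↔ ∀ p ∈ f.support, m ≤ p.1.length := Iff.rfl

theorem lmapDomain_mem_wordsOfLengthGe {t : List X × G → List X × G}
    (ht : ∀ p, p.1.length ≤ (t p).1.length) (m : ℕ) (f : List X × G →₀ K)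
    (hf : f ∈ wordsOfLengthGe G X K (m + 1)) :
    Finsupp.lmapDomain K K t f ∈ wordsOfLengthGe G X K m := by
  classical
  intro p hp
  obtain ⟨p', h, rfl⟩ := Finset.mem_image.1 (Finsupp.mapDomain_support hp)
  have h1 := mem_wordsOfLengthGe.1 hf p' h
  have h2 := ht p'
  change m ≤ _
  omega

theorem consLeft_mem_wordsOfLengthGe (x : X) (m : ℕ) (f : List X × G →₀ K)
    (hf : f ∈ wordsOfLengthGe G X K (m + 1)) : consLeft K x f ∈ wordsOfLengthGe G X K m :=
  lmapDomain_mem_wordsOfLengthGe (fun p => by simp) m f hf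

theorem stripLeft_mem_wordsOfLengthGe (x : X) (m : ℕ) (f : List X × G →₀ K)
    (hf : f ∈ wordsOfLengthGe G X K (m + 1)) : stripLeft K [x] f ∈ wordsOfLengthGe G X K m := by
  intro p hp
  have := mem_wordsOfLengthGe.1 hf (x :: p.1, p.2) (by simpa [stripLeft_apply] using hp)
  simpa using this

theorem stripLeft_consLeft_self (x : X) (f : List X × G →₀ K) :
    stripLeft K [x] (consLeft K x f) = f := by
  induction f using Finsupp.induction_linear with
  | zero => simp
  | add f g hf hg => simp [hf, hg]
  | single p c => obtain ⟨u, h⟩ := p; simpa using stripLeft_single_append K [x] u h c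

theorem stripLeft_consLeft_of_ne {x y : X} (hxy : x ≠ y) (f : List X × G →₀ K) :
    stripLeft K [y] (consLeft K x f) = 0 := by
  induction f using Finsupp.induction_linear with
  | zero => simp
  | add f g hf hg => simp [hf, hg]
  | single p c =>
    obtain ⟨u, h⟩ := p
    rw [consLeft_single]
    exact stripLeft_single_of_not_prefix K (by simpa using hxy.symm) h c

end Filtration

variable {G X : Type*} [Group G] (K : Type*) [Field K] (S : SelfSimilarAction G X)

theorem actLeft_mem_wordsOfLengthGe (g : G) (m : ℕ) (f : List X × G →₀ K)
    (hf : f ∈ wordsOfLengthGe G X K (m + 1)) : S.actLeft K g f ∈ wordsOfLengthGe G X K m :=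
  lmapDomain_mem_wordsOfLengthGe (fun p => by simp [S.length_map]) m f hf

theorem actLeft_actLeft (g h : G) (f : List X × G →₀ K) :
    S.actLeft K g (S.actLeft K h f) = S.actLeft K (g * h) f := by
  induction f using Finsupp.induction_linear with
  | zero => simp
  | add f g hf hg => simp [hf, hg]
  | single p c => obtain ⟨u, h⟩ := p; simp [secWord_mul, mul_assoc]

theorem actLeft_one (f : List X × G →₀ K) : S.actLeft K 1 f = f := by
  induction f using Finsupp.induction_linear with
  | zero => simp
  | add f g hf hg => simp [hf, hg]
  | single p c => obtain ⟨u, h⟩ := p; simp [secWord_one]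

theorem actLeft_consLeft (g : G) (x : X) (f : List X × G →₀ K) :
    S.actLeft K g (consLeft K x f) =
      consLeft K (S.letter g x) (S.actLeft K (S.sec g x) f) := by
  induction f using Finsupp.induction_linear with
  | zero => simp
  | add f g hf hg => simp [hf, hg]
  | single p c => obtain ⟨u, h⟩ := p; simp [map_cons, secWord]

theorem letter_inv_eq_iff (g : G) (x y : X) : S.letter g⁻¹ y = x ↔ y = S.letter g x := by
  constructor
  · rintro rfl
    rw [← letter_mul, mul_inv_cancel, letter_one]
  · rintro rfl
    rw [← letter_mul, inv_mul_cancel, letter_one]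

theorem sec_inv (g : G) (x : X) : S.sec g⁻¹ (S.letter g x) = (S.sec g x)⁻¹ := by
  rw [eq_inv_iff_mul_eq_one, ← sec_mul, inv_mul_cancel, sec_one]

/-- The formal counterpart of the adjoint relation x* g* = (g|_x)* g(x)*. -/
theorem stripLeft_actLeft_inv (g : G) (x : X) (f : List X × G →₀ K) :
    stripLeft K [x] (S.actLeft K g⁻¹ f) =
      S.actLeft K (S.sec g x)⁻¹ (stripLeft K [S.letter g x] f) := by
  induction f using Finsupp.induction_linear with
  | zero => simp
  | add f g hf hg => simp only [map_add, hf, hg]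
  | single p c =>
    obtain ⟨u, h⟩ := p
    rw [actLeft_single]
    cases u with
    | nil =>
      rw [toPerm_nil, stripLeft_single_of_not_prefix K (by simp),
        stripLeft_single_of_not_prefix K (by simp), map_zero]
    | cons y u =>
      by_cases hy : y = S.letter g x
      · subst hy
        have h1 := stripLeft_single_append K [S.letter g x] u h c
        have h2 := stripLeft_single_append K [x] (S.toPerm (S.sec g x)⁻¹ u)
          (S.secWord (S.sec g x)⁻¹ u * h) c
        rw [List.singleton_append] at h1 h2
        rw [h1, actLeft_single, map_cons, secWord, (S.letter_inv_eq_iff g x _).2 rfl, sec_inv, h2]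
      · rw [map_cons, stripLeft_single_of_not_prefix K, stripLeft_single_of_not_prefix K, map_zero]
        · simpa using Ne.symm hy
        · simpa [eq_comm (a := x), S.letter_inv_eq_iff] using hy

/-- The operator on germs given by a generator. -/
noncomputable def genGerm : NekGen G X → Module.End K (GermModule X (wordsOfLengthGe G X K))
  | .letter x => germMap _ (consLeft_mem_wordsOfLengthGe x)
  | .letterStar x => germMap _ (stripLeft_mem_wordsOfLengthGe x)
  | .elt g => germMap _ (S.actLeft_mem_wordsOfLengthGe K g)
  | .eltStar g => germMap _ (S.actLeft_mem_wordsOfLengthGe K g⁻¹)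

variable [Fintype X]

theorem genGerm_rel {a b : FreeAlgebra K (NekGen G X)} (h : NekRel K S a b) :
    FreeAlgebra.lift K (S.genGerm K) a = FreeAlgebra.lift K (S.genGerm K) b := by
  apply LinearMap.ext
  intro φ
  obtain ⟨φ, rfl⟩ := Submodule.Quotient.mk_surjective _ φ
  induction h with
  | elt_star g => simp only [FreeAlgebra.lift_ι_apply]; rfl
  | elt_mul g h =>
    simp only [FreeAlgebra.lift_ι_apply, map_mul, Module.End.mul_apply, genGerm, germMap_mk]
    exact germ_eq ⟨0, fun w _ => S.actLeft_actLeft K g h _⟩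
  | elt_one =>
    simp only [FreeAlgebra.lift_ι_apply, map_one, Module.End.one_apply, genGerm, germMap_mk]
    exact germ_eq ⟨0, fun w _ => S.actLeft_one K _⟩
  | ss g x =>
    simp only [FreeAlgebra.lift_ι_apply, map_mul, Module.End.mul_apply, genGerm, germMap_mk]
    exact germ_eq ⟨0, fun w _ => S.actLeft_consLeft K g x _⟩
  | ss_star g x =>
    simp only [FreeAlgebra.lift_ι_apply, map_mul, Module.End.mul_apply, genGerm, germMap_mk]
    refine germ_eq ⟨0, fun w _ => ?_⟩
    change stripLeft K [x] (S.actLeft K g⁻¹ (φ.1 w)) =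
      S.actLeft K (S.sec g x)⁻¹ (stripLeft K [S.letter g x] (φ.1 w))
    exact S.stripLeft_actLeft_inv K g x _
  | ck1_same x =>
    simp only [FreeAlgebra.lift_ι_apply, map_mul, map_one, Module.End.mul_apply,
      Module.End.one_apply, genGerm, germMap_mk]
    exact germ_eq ⟨0, fun w _ => stripLeft_consLeft_self x _⟩
  | ck1_ne x y hxy =>
    simp only [FreeAlgebra.lift_ι_apply, map_mul, map_zero, Module.End.mul_apply,
      LinearMap.zero_apply, genGerm, germMap_mk]
    rw [← Submodule.Quotient.mk_zero]
    exact germ_eq ⟨0, fun w _ => stripLeft_consLeft_of_ne hxy _⟩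
  | ck2 =>
    simp only [FreeAlgebra.lift_ι_apply, map_mul, map_one, map_sum, Module.End.mul_apply,
      LinearMap.sum_apply, Module.End.one_apply, genGerm, germMap_mk]
    rw [← Submodule.mkQ_apply]
    simp only [← Submodule.mkQ_apply, ← map_sum]
    -- Growth of the family is used here: for long w no empty word occurs in φ(w), and only then is
    -- ∑ x x* the identity.
    obtain ⟨n, hn⟩ := φ.2 1
    refine germ_eq ⟨n, fun w hw => ?_⟩
    rw [AddSubmonoidClass.coe_finsetSum, Finset.sum_apply]
    exact sum_consLeft_stripLeft K (hn w hw)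

/-- The representation of the Nekrashevych algebra on germs. -/
noncomputable def germRep : NekAlgebra K S →ₐ[K] Module.End K (GermModule X (wordsOfLengthGe G X K)) :=
  RingQuot.liftAlgHom K ⟨FreeAlgebra.lift K (S.genGerm K), fun _ _ h => S.genGerm_rel K h⟩

theorem germRep_mk (a : FreeAlgebra K (NekGen G X)) :
    S.germRep K (NekAlgebra.mk K S a) = FreeAlgebra.lift K (S.genGerm K) a :=
  RingQuot.liftAlgHom_mkAlgHom_apply K _ _ a

/-- The family `w ↦ f w` given by a formal sum. -/
noncomputable def orbitFamily : (List X × G →₀ K) →ₗ[K] growing X (wordsOfLengthGe G X K) where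
  toFun f := ⟨fun w => S.appendRight K w f,
    fun m => ⟨m, fun w hw => S.le_length_of_mem_support_appendRight K m w hw f⟩⟩
  map_add' f g := by ext1; funext w; simp
  map_smul' c f := by ext1; funext w; simp

theorem germRep_letter (x : X) (f : List X × G →₀ K) :
    S.germRep K (NekAlgebra.letter K S x) (Submodule.Quotient.mk (S.orbitFamily K f)) =
      Submodule.Quotient.mk (S.orbitFamily K (consLeft K x f)) := by
  rw [NekAlgebra.letter, germRep_mk, FreeAlgebra.lift_ι_apply, genGerm, germMap_mk]
  exact germ_eq ⟨0, fun w _ => S.consLeft_appendRight K x w f⟩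

theorem germRep_elt (g : G) (f : List X × G →₀ K) :
    S.germRep K (NekAlgebra.elt K S g) (Submodule.Quotient.mk (S.orbitFamily K f)) =
      Submodule.Quotient.mk (S.orbitFamily K (S.actLeft K g f)) := by
  rw [NekAlgebra.elt, germRep_mk, FreeAlgebra.lift_ι_apply, genGerm, germMap_mk]
  exact germ_eq ⟨0, fun w _ => S.actLeft_appendRight K g w f⟩

theorem germRep_word_mul_elt (u : List X) (g : G) :
    S.germRep K (NekAlgebra.word K S u * NekAlgebra.elt K S g)
      (Submodule.Quotient.mk (S.orbitFamily K (Finsupp.single ([], 1) 1))) =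
      Submodule.Quotient.mk (S.orbitFamily K (Finsupp.single (u, g) 1)) := by
  induction u with
  | nil => simp [germRep_elt, toPerm_nil, secWord]
  | cons x u ih =>
    rw [NekAlgebra.word_cons, mul_assoc, map_mul, Module.End.mul_apply, ih, germRep_letter,
      consLeft_single]

theorem germRep_eval (f : List X × G →₀ K) :
    S.germRep K (NekAlgebra.eval K S f)
      (Submodule.Quotient.mk (S.orbitFamily K (Finsupp.single ([], 1) 1))) =
      Submodule.Quotient.mk (S.orbitFamily K f) := by
  induction f using Finsupp.induction_linear with
  | zero => simp
  | add f g hf hg => simp only [map_add, LinearMap.add_apply, hf, hg, Submodule.Quotient.mk_add]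
  | single p c =>
    obtain ⟨u, h⟩ := p
    rw [NekAlgebra.eval_single, map_smul, LinearMap.smul_apply, germRep_word_mul_elt,
      ← Submodule.Quotient.mk_smul, ← map_smul, Finsupp.smul_single, smul_eq_mul, mul_one]

namespace NekAlgebra

/-- The word problem in the algebra: a formal sum vanishes in the algebra exactly when all its
products with sufficiently long words vanish formally. -/
theorem eval_eq_zero_iff (f : List X × G →₀ K) :
    eval K S f = 0 ↔ ∃ n : ℕ, ∀ w : List X, n ≤ w.length → S.appendRight K w f = 0 := by
  constructor
  · intro h
    -- The value of f sends the germ of w ↦ w to the germ of w ↦ f w; if the value is zero, so is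
    -- that germ.
    have h1 := S.germRep_eval K f
    rw [h, map_zero, LinearMap.zero_apply, eq_comm, Submodule.Quotient.mk_eq_zero] at h1
    exact h1
  · rintro ⟨n, hn⟩
    exact eval_eq_zero_of_appendRight K S (n := n) fun w hw => hn w hw.ge

end NekAlgebra

end SelfSimilarAction

/-! ### Singular elements and simplicity -/

namespace SelfSimilarAction

variable {G X : Type*} [Group G] [Fintype X] {K : Type*} [Field K] {S : SelfSimilarAction G X}

namespace NekAlgebra

theorem eval_single_ne_zero [Nonempty X] (u : List X) (g : G) {c : K} (hc : c ≠ 0) :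
    eval K S (Finsupp.single (u, g) c) ≠ 0 := by
  intro h
  obtain ⟨n, hn⟩ := (eval_eq_zero_iff K S _).1 h
  simpa [hc] using hn (List.replicate n (Classical.arbitrary X)) (by simp)

theorem word_ne_zero [Nonempty X] (w : List X) : word K S w ≠ 0 := by
  simpa [elt_one] using eval_single_ne_zero (S := S) w 1 (one_ne_zero (α := K))

/-- The set of words that do not annihilate `b` from the right is nowhere dense. -/
def IsSingular (b : NekAlgebra K S) : Prop :=
  ∀ p : List X, ∃ s : List X, b * word K S p * word K S s = 0

theorem IsSingular.zero : IsSingular (0 : NekAlgebra K S) := fun _ => ⟨[], by simp⟩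

theorem IsSingular.add {a b : NekAlgebra K S} (ha : IsSingular a) (hb : IsSingular b) :
    IsSingular (a + b) := by
  intro p
  obtain ⟨s, hs⟩ := ha p
  obtain ⟨t, ht⟩ := hb (p ++ s)
  refine ⟨s ++ t, ?_⟩
  rw [word_append] at ht
  rw [word_append, add_mul, add_mul, ← mul_assoc, hs, zero_mul, zero_add]
  simpa only [mul_assoc] using ht

theorem IsSingular.mul_left (a : NekAlgebra K S) {b : NekAlgebra K S} (hb : IsSingular b) :
    IsSingular (a * b) := by
  intro p
  obtain ⟨s, hs⟩ := hb p
  exact ⟨s, by rw [mul_assoc a, mul_assoc a, hs, mul_zero]⟩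

theorem IsSingular.mul_right {b : NekAlgebra K S} (hb : IsSingular b) (a : NekAlgebra K S) :
    IsSingular (b * a) := by
  induction a using induction generalizing b with
  | add a a' ha ha' => rw [mul_add]; exact (ha hb).add (ha' hb)
  | mul a a' ha ha' => rw [← mul_assoc]; exact ha' (ha hb)
  | scalar c => rw [← Algebra.commutes]; exact hb.mul_left _
  | letter x =>
    intro p
    obtain ⟨s, hs⟩ := hb (x :: p)
    exact ⟨s, by rw [← hs, word_cons, ← mul_assoc]⟩
  | star x =>
    have key : ∀ (y : X) (p : List X), ∃ s, b * star K S x * word K S (y :: p) * word K S s = 0 := by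
      intro y p
      obtain ⟨s, hs⟩ := hb p
      refine ⟨s, ?_⟩
      rw [word_cons, mul_assoc b, ← mul_assoc (star K S x)]
      by_cases hxy : y = x
      · subst hxy
        rw [star_mul_letter_self, one_mul, hs]
      · rw [star_mul_letter_of_ne K S hxy, zero_mul, mul_zero, zero_mul]
    intro p
    cases p with
    | nil =>
      -- `key` needs a nonempty word, so a letter is put in front; any letter would do.
      obtain ⟨s, hs⟩ := key x []
      exact ⟨x :: s, by rw [← hs, word_cons, word_cons]; simp [mul_assoc]⟩
    | cons y p => exact key y p
  | elt g =>
    intro p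
    obtain ⟨s, hs⟩ := hb (S.toPerm g p)
    -- The annihilating word is pulled back through g|_p, since moving g past p s turns it into g(p)
    -- g|_p(s).
    obtain ⟨s, rfl⟩ := (S.toPerm (S.secWord g p)).surjective s
    refine ⟨s, ?_⟩
    have h1 : b * elt K S g * word K S p * word K S s =
        b * word K S (S.toPerm g p) * word K S (S.toPerm (S.secWord g p) s) *
          elt K S (S.secWord (S.secWord g p) s) := by
      rw [mul_assoc b, elt_mul_word, ← mul_assoc, mul_assoc _ (elt K S _), elt_mul_word,
        ← mul_assoc]
    rw [h1, hs, zero_mul]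

theorem not_isSingular_one [Nonempty X] : ¬ IsSingular (1 : NekAlgebra K S) := by
  intro h
  obtain ⟨s, hs⟩ := h []
  exact word_ne_zero s (by simpa using hs)

variable (K S) in
/-- The ideal of singular elements. -/
noncomputable def singularIdeal : TwoSidedIdeal (NekAlgebra K S) :=
  .mk' {b | IsSingular b} IsSingular.zero IsSingular.add
    (fun {b} hb => by simpa using IsSingular.mul_left (-1) hb)
    (fun hb => hb.mul_left _) (fun hb => hb.mul_right _)

theorem mem_singularIdeal {b : NekAlgebra K S} : b ∈ singularIdeal K S ↔ IsSingular b :=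
  TwoSidedIdeal.mem_mk' _ _ _ _ _ _ _

theorem eq_zero_of_isSingular [Nonempty X] [IsSimpleRing (NekAlgebra K S)]
    {b : NekAlgebra K S} (hb : IsSingular b) : b = 0 := by
  rcases eq_bot_or_eq_top (singularIdeal K S) with h | h
  · rw [← mem_singularIdeal, h] at hb
    exact hb
  · exact absurd (mem_singularIdeal.1 (h ▸ trivial)) (not_isSingular_one (K := K) (S := S))

/-- Finitely many singular elements are annihilated by a common word. -/
theorem exists_forall_mul_word_eq_zero {ι : Type*} [Finite ι] {b : ι → NekAlgebra K S}
    (hb : ∀ i, IsSingular (b i)) : ∃ s : List X, ∀ i, b i * word K S s = 0 := by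
  classical
  have := Fintype.ofFinite ι
  suffices h : ∀ t : Finset ι, ∃ s : List X, ∀ i ∈ t, b i * word K S s = 0 by
    simpa using h Finset.univ
  intro t
  induction t using Finset.induction with
  | empty => exact ⟨[], by simp⟩
  | insert a t _ ih =>
    obtain ⟨s, hs⟩ := ih
    obtain ⟨s', hs'⟩ := hb a s
    refine ⟨s ++ s', fun i hi => ?_⟩
    rw [word_append, ← mul_assoc]
    rcases Finset.mem_insert.1 hi with rfl | hi
    · exact hs'
    · rw [hs i hi, zero_mul]

/-- Write b = ∑ x (x* b) and use one word that annihilates all the finitely many summands. -/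
theorem isSingular_of_star_mul {b : NekAlgebra K S} (h : ∀ x, IsSingular (star K S x * b)) :
    IsSingular b := by
  intro p
  obtain ⟨s, hs⟩ := exists_forall_mul_word_eq_zero fun x => (h x).mul_right (word K S p)
  refine ⟨s, ?_⟩
  rw [← one_mul b, ← sum_letter_mul_star, Finset.sum_mul, Finset.sum_mul, Finset.sum_mul]
  refine Finset.sum_eq_zero fun x _ => ?_
  have := congrArg (letter K S x * ·) (hs x)
  simpa only [mul_assoc, mul_zero] using this

theorem isSingular_of_wordStar_mul (n : ℕ) {b : NekAlgebra K S}
    (h : ∀ q : List X, q.length = n → IsSingular (wordStar K S q * b)) : IsSingular b := by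
  induction n with
  | zero => simpa using h [] rfl
  | succ n ih =>
    refine ih fun q hq => isSingular_of_star_mul fun x => ?_
    have := h (q ++ [x]) (by simp [hq])
    rwa [wordStar_append, wordStar_cons, wordStar_nil, one_mul, mul_assoc] at this

/-- Outside the singular ideal there is a word after which no word annihilates. -/
theorem exists_forall_mul_word_ne_zero {b : NekAlgebra K S} (hb : ¬ IsSingular b) :
    ∃ p : List X, ∀ s, b * word K S p * word K S s ≠ 0 := by
  simpa [IsSingular] using hb

theorem not_isSingular_of_forall {b : NekAlgebra K S} (hb : ∀ s, b * word K S s ≠ 0) :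
    ¬ IsSingular b := by
  intro h
  obtain ⟨s, hs⟩ := h []
  exact hb s (by simpa using hs)

variable (K S) in
/-- The formal sums with value in the ideal `I` that are annihilated by no word. -/
def persistent (I : TwoSidedIdeal (NekAlgebra K S)) : Set (List X × G →₀ K) :=
  {f | eval K S f ∈ I ∧ ∀ s, eval K S f * word K S s ≠ 0}

theorem appendRight_mem_persistent {I : TwoSidedIdeal (NekAlgebra K S)} {f : List X × G →₀ K}
    (hf : f ∈ persistent K S I) (s : List X) : S.appendRight K s f ∈ persistent K S I := by
  refine ⟨?_, fun t => ?_⟩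
  · rw [eval_appendRight]
    exact I.mul_mem_right _ _ hf.1
  · rw [eval_appendRight, mul_assoc, ← word_append]
    exact hf.2 _

theorem exists_persistent {I : TwoSidedIdeal (NekAlgebra K S)} {b : NekAlgebra K S} (hb : b ∈ I)
    (hb' : ¬ IsSingular b) [Nonempty X] : ∃ f, f ∈ persistent K S I := by
  obtain ⟨p, hp⟩ := exists_forall_mul_word_ne_zero hb'
  obtain ⟨n, hn⟩ := exists_mul_word_mem_range K S (b * word K S p)
  obtain ⟨f, hf⟩ := hn (List.replicate n (Classical.arbitrary X)) (by simp)
  refine ⟨f, ?_, fun s => ?_⟩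
  · rw [← hf]
    exact I.mul_mem_right _ _ (I.mul_mem_right _ _ hb)
  · rw [← hf, mul_assoc, ← word_append]
    exact hp _

/-- Some q* f with |q| = m is nonsingular, as otherwise f would be singular; multiplying by a
suitable p makes it persistent. -/
theorem exists_stripLeft_mem_persistent {I : TwoSidedIdeal (NekAlgebra K S)}
    {f : List X × G →₀ K} (hf : f ∈ persistent K S I) (m : ℕ)
    (hm : ∀ p ∈ f.support, m ≤ p.1.length) :
    ∃ q p : List X, q.length = m ∧ stripLeft K q (S.appendRight K p f) ∈ persistent K S I := by
  obtain ⟨q, hq, h⟩ : ∃ q : List X, q.length = m ∧ ¬ IsSingular (wordStar K S q * eval K S f) := by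
    by_contra! h
    exact not_isSingular_of_forall hf.2 (isSingular_of_wordStar_mul m h)
  obtain ⟨p, hp⟩ := exists_forall_mul_word_ne_zero h
  have e : eval K S (stripLeft K q (S.appendRight K p f)) =
      wordStar K S q * eval K S f * word K S p := by
    rw [eval_stripLeft, eval_appendRight, mul_assoc]
    intro r hr
    obtain ⟨r', hr', rfl⟩ := S.support_appendRight_subset K p f hr
    have := hm r' hr'
    simp
    omega
  refine ⟨q, p, hq, ?_, ?_⟩
  · rw [e]
    exact I.mul_mem_right _ _ (I.mul_mem_left _ _ hf.1)
  · rw [e]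
    exact hp

/-- In a persistent formal sum with as few terms as possible all words have a common prefix. -/
theorem take_eq_take_of_minimal {I : TwoSidedIdeal (NekAlgebra K S)} {f : List X × G →₀ K}
    (hf : f ∈ persistent K S I)
    (hmin : ∀ f' ∈ persistent K S I, f.support.card ≤ f'.support.card) (m : ℕ)
    (hm : ∀ p ∈ f.support, m ≤ p.1.length) {r r' : List X × G} (hr : r ∈ f.support)
    (hr' : r' ∈ f.support) : r.1.take m = r'.1.take m := by
  obtain ⟨q, p, rfl, hq⟩ := exists_stripLeft_mem_persistent hf m hm
  -- Neither operation increases the number of terms, so by minimality all three cardinalities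
  -- coincide.
  have h1 := hmin _ hq
  have h2 := card_support_stripLeft_le K q (S.appendRight K p f)
  have h3 := S.card_support_appendRight_le K p f
  have key : ∀ r ∈ f.support, r.1.take q.length = q := by
    intro r hr
    have h4 := prefix_of_card_support_stripLeft K q (S.appendRight K p f) (by omega)
      (S.mem_support_appendRight K p f (by omega) hr)
    have h5 := hm r hr
    have h6 : q <+: r.1 := List.prefix_of_prefix_length_le h4 (List.prefix_append _ _) h5
    exact (List.prefix_iff_eq_take.1 h6).symm
  rw [key r hr, key r' hr']

theorem eq_of_minimal (hX : 2 ≤ Fintype.card X) {I : TwoSidedIdeal (NekAlgebra K S)}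
    {f : List X × G →₀ K} (hf : f ∈ persistent K S I)
    (hmin : ∀ f' ∈ persistent K S I, f.support.card ≤ f'.support.card) {r r' : List X × G}
    (hr : r ∈ f.support) (hr' : r' ∈ f.support) : r = r' := by
  have key : ∀ r ∈ f.support, ∀ r' ∈ f.support, ∀ s : List X,
      (r.1 ++ S.toPerm r.2 s).take s.length = (r'.1 ++ S.toPerm r'.2 s).take s.length := by
    intro r hr r' hr' s
    -- Appending s keeps the sum persistent and minimal, and makes all its words at least as long as
    -- s.
    have h1 := appendRight_mem_persistent hf s
    have h2 := S.card_support_appendRight_le K s f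
    have h3 : (S.appendRight K s f).support.card = f.support.card := le_antisymm h2 (hmin _ h1)
    exact take_eq_take_of_minimal h1 (fun f' hf' => h2.trans (hmin f' hf')) s.length
      (S.le_length_of_mem_support_appendRight K _ s le_rfl f)
      (S.mem_support_appendRight K s f h3 hr) (S.mem_support_appendRight K s f h3 hr')
  have : Nonempty X := Fintype.card_pos_iff.1 (by omega)
  have hlt : ∀ r ∈ f.support, ∀ r' ∈ f.support, ¬ r.1.length < r'.1.length := by
    rintro ⟨u, g⟩ hr ⟨v, h⟩ hr' hlt
    obtain ⟨x, y, hxy⟩ := Fintype.exists_pair_of_one_lt_card (α := X) (by omega)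
    -- If v is longer than u, the letter after u is prescribed by v and cannot depend on z,
    -- contradicting injectivity of g on two letters.
    have hz : ∀ z : X, u ++ [S.letter g z] = v.take (u.length + 1) := by
      intro z
      have h1 := key _ hr _ hr' (z :: List.replicate u.length z)
      rw [map_cons, List.append_cons, ← List.take_append_drop (u.length + 1) v,
        List.append_assoc (v.take _)] at h1
      have h2 : u.length + 1 ≤ v.length := hlt
      exact eq_of_take_append_eq h1 (by simp; omega) (by simp)
    have := (hz x).trans (hz y).symm
    exact hxy (S.letter_injective g (by simpa using this))
  have hl : r.1.length = r'.1.length :=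
    le_antisymm (not_lt.1 (hlt r' hr' r hr)) (not_lt.1 (hlt r hr r' hr'))
  obtain ⟨u, g⟩ := r
  obtain ⟨v, h⟩ := r'
  have hs : ∀ s : List X, u ++ S.toPerm g s = v ++ S.toPerm h s := by
    intro s
    -- The padding by |u| letters makes the compared prefix cover all of u g(s).
    have h1 := key _ hr _ hr' (s ++ List.replicate u.length (Classical.arbitrary X))
    simp only [toPerm_append, ← List.append_assoc] at h1
    have h2 : u.length = v.length := hl
    exact eq_of_take_append_eq h1 (by simp [S.length_map, h2])
      (by simp [S.length_map, Nat.add_comm])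
  have huv : u = v := by simpa [toPerm_nil] using hs []
  subst huv
  have hgh : g = h := by
    apply S.faithful
    ext1 s
    simpa using hs s
  rw [hgh]

/-- If there are no nonzero singular elements, then the Nekrashevych algebra is simple. -/
theorem isSimpleRing_of_forall_isSingular (hX : 2 ≤ Fintype.card X)
    (h : ∀ b : NekAlgebra K S, IsSingular b → b = 0) : IsSimpleRing (NekAlgebra K S) := by
  have : Nonempty X := Fintype.card_pos_iff.1 (by omega)
  have : Nontrivial (NekAlgebra K S) := ⟨1, 0, by simpa using word_ne_zero (K := K) (S := S) []⟩
  refine ⟨⟨fun I => or_iff_not_imp_left.2 fun hI => ?_⟩⟩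
  obtain ⟨b, hb, hb0⟩ : ∃ b ∈ I, b ≠ 0 := by
    by_contra! hc
    exact hI (eq_bot_iff.2 fun b hb => hc b hb)
  have hne : (persistent K S I).Nonempty := exists_persistent hb (mt (h b) hb0)
  set f := Function.argminOn (fun f : List X × G →₀ K => f.support.card) (persistent K S I) hne
  have hf : f ∈ persistent K S I := Function.argminOn_mem _ _ hne
  have hmin : ∀ f' ∈ persistent K S I, f.support.card ≤ f'.support.card := fun f' hf' =>
    Function.argminOn_le (fun f : List X × G →₀ K => f.support.card) _ hf'
  obtain ⟨⟨u, g⟩, hr⟩ : f.support.Nonempty := by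
    rw [Finsupp.support_nonempty_iff]
    intro h0
    exact hf.2 [] (by simp [h0])
  obtain ⟨c, hc⟩ : ∃ c, f = Finsupp.single (u, g) c := by
    rw [← Finsupp.support_subset_singleton']
    intro r' hr'
    exact Finset.mem_singleton.2 (eq_of_minimal hX hf hmin hr' hr)
  have hc0 : c ≠ 0 := by
    rintro rfl
    simp [hc] at hr
  have h1 : c⁻¹ • (elt K S g⁻¹ * (wordStar K S u * eval K S f)) = 1 := by
    rw [hc, eval_single, mul_smul_comm, mul_smul_comm, smul_smul, inv_mul_cancel₀ hc0, one_smul,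
      ← mul_assoc (wordStar K S u), wordStar_mul_word_self, one_mul, elt_mul, inv_mul_cancel,
      elt_one]
  rw [← TwoSidedIdeal.one_mem_iff, ← h1, Algebra.smul_def]
  exact I.mul_mem_left _ _ (I.mul_mem_left _ _ (I.mul_mem_left _ _ hf.1))

end NekAlgebra

end SelfSimilarAction

/-! ### The simplicity graph and its linear systems -/

namespace SelfSimilarAction

variable {G X : Type*} [Group G] {S : SelfSimilarAction G X}

namespace Automaton

variable (A : Automaton S)

section Graph

/-- The action of words on equivalence relations, extending that of letters. -/
def dotWord (u : List X) (r : Setoid A.states) : Setoid A.states := u.foldr A.dot r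

theorem eqv_append (u w : List X) : A.eqv (u ++ w) = A.dotWord u (A.eqv w) := by
  induction u with
  | nil => rfl
  | cons x u ih => rw [List.cons_append, eqv, ih]; rfl

theorem eqv_iff (w : List X) (g h : A.states) :
    A.eqv w g h ↔ S.toPerm g w = S.toPerm h w ∧ S.secWord g w = S.secWord h w := by
  induction w generalizing g h with
  | nil => exact ⟨fun h => ⟨by rw [toPerm_nil, toPerm_nil], congrArg Subtype.val h⟩,
      fun h => Subtype.ext h.2⟩
  | cons x w ih =>
    have h1 : A.eqv (x :: w) g h ↔
      S.letter g x = S.letter h x ∧ A.eqv w (A.next g x) (A.next h x) := Iff.rfl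
    rw [h1, ih, map_cons, map_cons, secWord, secWord, List.cons.injEq, and_assoc]
    rfl

/-- The vertex `≡_w` of the simplicity graph. -/
def vertex (w : List X) : A.Vertex := ⟨A.eqv w, w, rfl⟩

theorem exists_eq_vertex (v : A.Vertex) : ∃ w, v = A.vertex w := by
  obtain ⟨w, hw⟩ := v.exists_word
  exact ⟨w, Vertex.ext hw⟩

instance : Finite A.Vertex := by
  apply Finite.of_injective fun (v : A.Vertex) (g h : A.states) => v.rel g h
  intro v v' h
  apply Vertex.ext
  apply Setoid.ext
  intro g g'
  exact iff_of_eq (congrFun (congrFun h g) g')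

theorem transGen_vertex {u : List X} (hu : u ≠ []) (w : List X) :
    Relation.TransGen A.Edge (A.vertex w) (A.vertex (u ++ w)) := by
  induction u with
  | nil => exact absurd rfl hu
  | cons x u ih =>
    have h1 : A.Edge (A.vertex (u ++ w)) (A.vertex (x :: u ++ w)) := ⟨x, rfl⟩
    by_cases h : u = []
    · subst h
      exact .single h1
    · exact (ih h).tail h1

theorem reaches_vertex (u w : List X) : A.Reaches (A.vertex w) (A.vertex (u ++ w)) := by
  by_cases hu : u = []
  · subst hu
    exact .refl
  · exact (A.transGen_vertex hu w).to_reflTransGen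

theorem exists_dotWord_of_transGen {v v' : A.Vertex} (h : Relation.TransGen A.Edge v v') :
    ∃ u : List X, u ≠ [] ∧ v'.rel = A.dotWord u v.rel := by
  induction h with
  | single h =>
    obtain ⟨x, hx⟩ := h
    exact ⟨[x], by simp, hx⟩
  | tail _ h ih =>
    obtain ⟨x, hx⟩ := h
    obtain ⟨u, -, hu⟩ := ih
    exact ⟨x :: u, by simp, by rw [hx, hu]; rfl⟩

theorem exists_dotWord_of_reaches {v v' : A.Vertex} (h : A.Reaches v v') :
    ∃ u : List X, v'.rel = A.dotWord u v.rel := by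
  rcases Relation.reflTransGen_iff_eq_or_transGen.1 h with rfl | h
  · exact ⟨[], rfl⟩
  · obtain ⟨u, -, hu⟩ := A.exists_dotWord_of_transGen h
    exact ⟨u, hu⟩

theorem mem_Vmin_iff {v : A.Vertex} : v ∈ A.Vmin ↔ ∀ v', A.Reaches v v' → A.Reaches v' v := by
  constructor
  · intro h v' hv'
    exact toAntisymmetrization_le_toAntisymmetrization_iff.1
      (h (toAntisymmetrization_le_toAntisymmetrization_iff.2 hv' : A.component v' ≤ A.component v))
  · intro h c hc
    induction c using Antisymmetrization.ind with
    | _ v' =>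
      exact toAntisymmetrization_le_toAntisymmetrization_iff.2
        (h v' (toAntisymmetrization_le_toAntisymmetrization_iff.1 hc))

theorem mem_Vmin_of_reaches {v v' : A.Vertex} (hv : v ∈ A.Vmin) (h : A.Reaches v v') :
    v' ∈ A.Vmin :=
  A.mem_Vmin_iff.2 fun v'' hv'' => (A.mem_Vmin_iff.1 hv v'' (h.trans hv'')).trans h

theorem exists_vertex_mem_Vmin : ∃ w, A.vertex w ∈ A.Vmin := by
  have : Finite A.Component := Quotient.finite _
  obtain ⟨c, -, hc⟩ := (Set.finite_univ (α := A.Component)).exists_minimal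
    ⟨A.component (A.vertex []), trivial⟩
  induction c using Antisymmetrization.ind with
  | _ v =>
    obtain ⟨w, rfl⟩ := A.exists_eq_vertex v
    exact ⟨w, fun c hc' => hc trivial hc'⟩

/-- Going around the cycle repeatedly before following the path to v lengthens the word at will. -/
theorem exists_le_length_of_mem_Vess {v : A.Vertex} (hv : v ∈ A.Vess) (n : ℕ) :
    ∃ w : List X, n ≤ w.length ∧ v.rel = A.eqv w := by
  obtain ⟨u, hu, huv⟩ := hv
  obtain ⟨r, hr, hru⟩ := A.exists_dotWord_of_transGen hu
  obtain ⟨q, hq⟩ := A.exists_dotWord_of_reaches huv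
  suffices h : ∃ w : List X, n ≤ w.length ∧ u.rel = A.eqv w by
    obtain ⟨w, hw, huw⟩ := h
    exact ⟨q ++ w, by simp; omega, by rw [hq, huw, eqv_append]⟩
  induction n with
  | zero =>
    obtain ⟨w, hw⟩ := u.exists_word
    exact ⟨w, Nat.zero_le _, hw⟩
  | succ n ih =>
    obtain ⟨w, hw, huw⟩ := ih
    have := List.length_pos_iff.2 hr
    exact ⟨r ++ w, by simp; omega, by rw [eqv_append, ← huw, ← hru]⟩

theorem vertex_mem_Vess {w : List X} (hw : Nat.card A.Vertex ≤ w.length) :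
    A.vertex w ∈ A.Vess := by
  -- A word has |w| + 1 suffixes, more than there are vertices; two suffixes with the same vertex
  -- bound a cycle from which ≡_w is reached.
  have hni : ¬ Function.Injective fun i : Fin (w.length + 1) => A.vertex (w.drop i) := by
    intro h
    have := Nat.card_le_card_of_injective _ h
    simp at this
    omega
  obtain ⟨i, j, hij, hlt⟩ : ∃ i j : Fin (w.length + 1),
      A.vertex (w.drop i) = A.vertex (w.drop j) ∧ i < j := by
    simp only [Function.Injective, not_forall] at hni
    obtain ⟨i, j, h, hne⟩ := hni
    rcases lt_or_gt_of_ne hne with h' | h'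
    · exact ⟨i, j, h, h'⟩
    · exact ⟨j, i, h.symm, h'⟩
  have hd : w.drop i = (w.drop i).take (j - i) ++ w.drop j := by
    conv_lhs => rw [← List.take_append_drop (j - i) (w.drop i)]
    rw [List.drop_drop, Nat.add_sub_cancel' (le_of_lt hlt)]
  refine ⟨A.vertex (w.drop i), ?_, ?_⟩
  · have h1 := A.transGen_vertex (u := (w.drop i).take (j - i)) (by
      have := j.2
      have : i.1 < j.1 := hlt
      rw [← List.length_pos_iff]
      simp
      omega) (w.drop j)
    rwa [← hd, ← hij] at h1
  · simpa using A.reaches_vertex (w.take i) (w.drop i)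

end Graph

section System

variable {K : Type*} [Field K]

/-- The formal sum `∑ c_g g` over the states. -/
noncomputable def formalSum (c : A.states → K) : List X × G →₀ K :=
  ∑ g : A.states, Finsupp.single ([], (g : G)) (c g)

/-- By `eqv_iff`, g ≡_w h means that g and h yield the same term after appending w, so the
coefficients of the result are the class sums of c. -/
theorem isSolution_system_eqv_iff (w : List X) (c : A.states → K) :
    IsSolution (A.system (A.eqv w)) c ↔ S.appendRight K w (A.formalSum c) = 0 := by
  classical
  have h1 : ∀ p : List X × G, S.appendRight K w (A.formalSum c) p =
      ∑ g : A.states, if (S.toPerm g w, S.secWord g w) = p then c g else 0 := by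
    intro p
    simp only [formalSum, map_sum, appendRight_single, List.nil_append, Finsupp.finsetSum_apply,
      Finsupp.single_apply]
  have h2 : ∀ h : A.states, S.appendRight K w (A.formalSum c) (S.toPerm h w, S.secWord h w) =
      ∑ g : A.states, (((if A.eqv w g h then 1 else 0 : ℤ)) : K) * c g := by
    intro h
    rw [h1]
    refine Finset.sum_congr rfl fun g _ => ?_
    simp only [Prod.mk.injEq, ← A.eqv_iff]
    split_ifs <;> simp
  constructor
  · intro h
    ext p
    by_cases hp : ∃ g : A.states, (S.toPerm g w, S.secWord g w) = p
    · obtain ⟨g, rfl⟩ := hp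
      rw [h2, Finsupp.zero_apply]
      convert h _ ⟨g, rfl⟩ using 4
    · rw [h1]
      push Not at hp
      exact Finset.sum_eq_zero fun g _ => if_neg (hp g)
  · rintro h _ ⟨g, rfl⟩
    have := h2 g
    rw [h, Finsupp.zero_apply] at this
    convert this.symm using 4

theorem isSolution_systemS_iff (c : A.states → K) :
    IsSolution A.systemS c ↔ ∀ v ∈ A.Vmin, IsSolution (A.system v.rel) c := by
  simp only [IsSolution, systemS, Set.mem_iUnion]
  exact ⟨fun h v hv f hf => h f ⟨v, hv, hf⟩, fun h f ⟨v, hv, hf⟩ => h v hv f hf⟩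

end System

end Automaton

/-! ### Singular combinations of states, and reduction to them -/

namespace NekAlgebra

variable {K : Type*} [Field K]

theorem appendRight_lengthPart (s : List X) (d : ℕ) (f : List X × G →₀ K) :
    S.appendRight K s (lengthPart d f) = lengthPart (d + s.length) (S.appendRight K s f) := by
  induction f using Finsupp.induction_linear with
  | zero => simp only [map_zero, lengthPart_zero]
  | add f g hf hg => simp only [lengthPart_add, map_add, hf, hg]
  | single p c =>
    obtain ⟨u, g⟩ := p
    by_cases hd : u.length = d
    · simp [lengthPart_single, S.length_map, hd]
    · simp [lengthPart_single, S.length_map, hd]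

variable [Fintype X]

/-- Appending s raises all word lengths by |s|, so the parts of different lengths vanish
independently. -/
theorem isSingular_eval_lengthPart [Nonempty X] {f : List X × G →₀ K}
    (hf : IsSingular (eval K S f)) (d : ℕ) : IsSingular (eval K S (lengthPart d f)) := by
  intro p
  obtain ⟨s, hs⟩ := hf p
  rw [← eval_appendRight, ← eval_appendRight, ← appendRight_append] at hs
  obtain ⟨n, hn⟩ := (eval_eq_zero_iff K S _).1 hs
  have hz := hn (List.replicate n (Classical.arbitrary X)) (by simp)
  rw [← appendRight_append] at hz
  refine ⟨s ++ List.replicate n (Classical.arbitrary X), ?_⟩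
  rw [← eval_appendRight, ← eval_appendRight, ← appendRight_append, ← List.append_assoc,
    appendRight_lengthPart, hz, lengthPart_zero, map_zero]

variable (A : Automaton S)

/-- Edges prepend letters: if ≡_s is minimal, so is ≡_{ps} for every p, and a single s serves all p.
-/
theorem isSingular_eval_formalSum {c : A.states → K} (hc : IsSolution A.systemS c) :
    IsSingular (eval K S (A.formalSum c)) := by
  intro p
  obtain ⟨s, hs⟩ := A.exists_vertex_mem_Vmin
  have h1 := (A.isSolution_systemS_iff c).1 hc _
    (A.mem_Vmin_of_reaches hs (A.reaches_vertex p s))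
  have h2 := (A.isSolution_system_eqv_iff (p ++ s) c).1 h1
  exact ⟨s, by rw [← eval_appendRight, ← eval_appendRight, ← appendRight_append, h2, map_zero]⟩

theorem isSolution_systemS_of_isSingular [Nonempty X] {c : A.states → K}
    (hc : IsSingular (eval K S (A.formalSum c))) : IsSolution A.systemS c := by
  rw [A.isSolution_systemS_iff]
  intro v hv
  have hr : ∀ v' : A.Vertex, ∃ r : List X, A.Reaches v' v → v.rel = A.dotWord r v'.rel := by
    intro v'
    by_cases h : A.Reaches v' v
    · obtain ⟨r, hr⟩ := A.exists_dotWord_of_reaches h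
      exact ⟨r, fun _ => hr⟩
    · exact ⟨[], fun h' => absurd h' h⟩
  choose r hr using hr
  -- The return path r(v') has to start at a vertex v' that itself depends on s. Finiteness of the
  -- graph allows choosing s for all v' in advance.
  obtain ⟨s, hs⟩ := exists_forall_mul_word_eq_zero fun v' => hc.mul_right (word K S (r v'))
  have hn : ∀ v', ∃ n : ℕ, ∀ w : List X, n ≤ w.length →
      S.appendRight K (r v' ++ s ++ w) (A.formalSum c) = 0 := by
    intro v'
    have h := hs v'
    rw [← eval_appendRight, ← eval_appendRight, ← appendRight_append, eval_eq_zero_iff] at h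
    simpa only [← appendRight_append] using h
  choose n hn using hn
  obtain ⟨m, hm⟩ := Finite.exists_le n
  obtain ⟨w, rfl⟩ := A.exists_eq_vertex v
  let t := List.replicate m (Classical.arbitrary X)
  -- By minimality v' leads back to v, so v is the vertex of r(v') s t w; the padding t turns
  -- vanishing in the algebra into formal vanishing.
  let v' := A.vertex (s ++ t ++ w)
  have h1 : (A.vertex w).rel = A.dotWord (r v') (A.eqv (s ++ t ++ w)) :=
    hr v' (A.mem_Vmin_iff.1 hv v' (A.reaches_vertex (s ++ t) w))
  rw [h1, ← A.eqv_append, A.isSolution_system_eqv_iff]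
  have h2 := hn v' (t ++ w) (by
    have := hm v'
    simp [t]
    omega)
  simpa only [List.append_assoc] using h2

/-- Multiplying by x* preserves singularity and lowers d; at d = 0 the sum is a combination of
states. -/
theorem eval_eq_zero_of_isSingular [Nonempty X]
    (hA : ∀ c : A.states → K, IsSingular (eval K S (A.formalSum c)) →
      eval K S (A.formalSum c) = 0) (d : ℕ) {f : List X × G →₀ K}
    (hd : ∀ p ∈ f.support, p.1.length = d ∧ p.2 ∈ A.states) (hf : IsSingular (eval K S f)) :
    eval K S f = 0 := by
  classical
  induction d generalizing f with
  | zero =>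
    have h : f = A.formalSum fun g => f ([], g) := by
      ext ⟨u, g⟩
      simp only [Automaton.formalSum, Finsupp.finsetSum_apply, Finsupp.single_apply]
      by_cases h : f (u, g) = 0
      · rw [h]
        refine (Finset.sum_eq_zero fun g' _ => ?_).symm
        split_ifs with h'
        · rw [h', h]
        · rfl
      · obtain ⟨hu, hg⟩ := hd _ (Finsupp.mem_support_iff.2 h)
        obtain rfl := List.length_eq_zero_iff.1 hu
        rw [Finset.sum_eq_single ⟨g, hg⟩]
        · simp
        · intro g' _ hne
          rw [if_neg]
          intro e
          exact hne (Subtype.ext (congrArg Prod.snd e))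
        · simp
    rw [h] at hf ⊢
    exact hA _ hf
  | succ d ih =>
    have h1 : ∀ x : X, star K S x * eval K S f = 0 := by
      intro x
      have e : eval K S (stripLeft K [x] f) = star K S x * eval K S f := by
        rw [eval_stripLeft, wordStar_cons, wordStar_nil, one_mul]
        intro p hp
        simp [(hd p hp).1]
      rw [← e]
      apply ih
      · intro p hp
        have := hd (x :: p.1, p.2) (by simpa [stripLeft_apply] using hp)
        simpa using this
      · rw [e]
        exact hf.mul_left _
    rw [← one_mul (eval K S f), ← sum_letter_mul_star, Finset.sum_mul]
    exact Finset.sum_eq_zero fun x _ => by rw [mul_assoc, h1, mul_zero]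

/-- In the contracting case the singular ideal is trivial as soon as it contains no nonzero
combination of the states of an automaton that contains the nucleus. -/
theorem eq_zero_of_isSingular_of_contracting [Nonempty X] (hS : S.IsContracting)
    (hN : S.nucleus ⊆ (A.states : Set G))
    (hA : ∀ c : A.states → K, IsSingular (eval K S (A.formalSum c)) →
      eval K S (A.formalSum c) = 0) {b : NekAlgebra K S} (hb : IsSingular b) : b = 0 := by
  classical
  obtain ⟨n, hn⟩ := exists_mul_word_mem_range K S b
  refine eq_zero_of_mul_word n fun w hw => ?_
  obtain ⟨f, hf⟩ := hn w hw.ge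
  rw [hf]
  -- Contraction: after appending any word of length m, all group elements in the sum lie in the
  -- nucleus.
  obtain ⟨m, hm⟩ := S.exists_forall_secWord_mem (S.nucleus_isLeast hS).1
    (f.support.image Prod.snd)
  refine eq_zero_of_mul_word m fun s hs => ?_
  have hsing : IsSingular (eval K S (S.appendRight K s f)) := by
    rw [eval_appendRight, ← hf]
    exact (hb.mul_right _).mul_right _
  rw [← eval_appendRight, ← sum_lengthPart (S.appendRight K s f), map_sum]
  refine Finset.sum_eq_zero fun d _ => ?_
  refine eval_eq_zero_of_isSingular A hA d ?_ (isSingular_eval_lengthPart hsing d)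
  intro p hp
  rw [lengthPart, Finsupp.support_filter, Finset.mem_filter] at hp
  refine ⟨hp.2, ?_⟩
  obtain ⟨p', hp', rfl⟩ := S.support_appendRight_subset K s f hp.1
  exact hN (hm _ (Finset.mem_image_of_mem _ hp') s hs.ge)

end NekAlgebra

end SelfSimilarAction

/-! ### The simplicity criterion -/

open SelfSimilarAction NekAlgebra in
theorem theoremt {G X : Type*} [Group G] [Fintype X] (hX : 2 ≤ Fintype.card X)
    (S : SelfSimilarAction G X) (hS : S.IsContracting) (K : Type*) [Field K]
    (A : SelfSimilarAction.Automaton S) (hA : S.nucleus ⊆ (A.states : Set G)) :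
    IsSimpleRing (SelfSimilarAction.NekAlgebra K S) ↔
      ∀ v : A.Vertex, v ∈ A.Vess → v ∉ A.Vmin → IsConsequence K (A.system v.rel) A.systemS := by
  have : Nonempty X := Fintype.card_pos_iff.1 (by omega)
  constructor
  · intro _ v hv _ c hc
    have h0 := eq_zero_of_isSingular (isSingular_eval_formalSum A hc)
    obtain ⟨n, hn⟩ := (eval_eq_zero_iff K S _).1 h0
    obtain ⟨w, hw, hvw⟩ := A.exists_le_length_of_mem_Vess hv n
    rw [hvw, A.isSolution_system_eqv_iff]
    exact hn w hw
  · intro h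
    refine isSimpleRing_of_forall_isSingular hX fun b hb =>
      eq_zero_of_isSingular_of_contracting A hS hA (fun c hc => ?_) hb
    have hcS := isSolution_systemS_of_isSingular A hc
    -- Words at least this long have essential vertices, which are either minimal or covered by the
    -- hypothesis.
    refine (eval_eq_zero_iff K S _).2 ⟨Nat.card A.Vertex, fun w hw => ?_⟩
    rw [← A.isSolution_system_eqv_iff]
    by_cases hmin : A.vertex w ∈ A.Vmin
    · exact (A.isSolution_systemS_iff c).1 hcS _ hmin
    · exact h _ (A.vertex_mem_Vess hw) hmin c hcS
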